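/- Let $p$ be an odd prime and let $\mathbb{C}_p$ be the completion of an algebraic closure of $\mathbb{Q}_p$, with $|p|_p = 1/p$. Write $D^{+}(c,r)$ and $D^{-}(c,r)$ for the closed and open discs with center $c$ and radius $r$. For $a, b \in \mathbb{C}_p$ with $a\neq b$, let $\mathcal{A}(a,b) = D^{-}(b,|b-a|_p)$. For a function $F\colon\mathcal{A}(a,b)\to\mathbb{C}_p$ and a function $\varphi$ from the positive integers to the positive integers put $$A_{F,\varphi}(k) = p^{-\varphi(k)} \sum_{\zeta^{p^{\varphi(k)}} = 1} (x_\zeta - a) F(x_\zeta), \qquad x_\zeta = a + (b-a)\zeta .$$ For an integer $\alpha \ge 0$ let $\Phi_\alpha = \{\, k \mapsto \alpha + \lambda k \mid \lambda = 1, 2, \dots \}$. One writes $\int_{\mathcal{A}(a,b),\Phi_\alpha} F(x)\,dx = L$ if for every $\varepsilon > 0$ there are $\varphi \in \Phi_\alpha$ and $K$ such that $|A_{F,\varphi}(k) - L|_p < \varepsilon$ for all $k > K$; such an $L$ is unique if it exists. For $|x|_p \le 1$ let $\omega(x) = 0$ if $|x|_p < 1$, and if $|x|_p = 1$ let $\omega(x)$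 be the unique root of unity of order prime to $p$ with $|x - \omega(x)|_p < 1$; write $\omega^m(x) = \omega(x)^m$. A function is holomorphic on $D^{+}(a,R)$ if it is given there by a single convergent power series, and meromorphic on $D^{+}(a,R)$ if it is a quotient $g/h$ of two functions holomorphic on $D^{+}(a,R)$ with $h$ not identically zero (removable singularities being removed). **Theorem.** Let $R > 0$, let $f$ be meromorphic on $D^{+}(a,R)$, let $|b - a|_p = R$, and let $\alpha\ge 0$ be an integer. 1. Let $M\ge 0$ and let $z_1,\dots,z_M \in D^{+}(a,R)$ be such that the discs $D_i = D^{-}(z_i,R)$ are pairwise disjoint, all zeros and poles of $f$ in $D^{+}(a,R)$ lie in $D_1 \cup \dots \cup D_M$, and $b$ lies in none of the $D_i$. Then $f$ has only finitely many zeros and poles in $D^{+}(a,R)$. Let $Z_i$ and $P_i$ be the numbers of zeros and of poles of $f$ in $D_i$, counted with multiplicity. Then all the denominators below are nonzero, the integral exists, and $$\int_{\mathcal{A}(a,b),\Phi_\alpha} \frac{f'(x)}{f(x)}\,dx = \sum_{i=1}^{M} \frac{1}{1 - \omega^{p^{\alpha}}\!\left(\frac{a - z_i}{a - b}\right)}\,(Z_i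 - P_i).$$ 2. If all zeros and poles of $f$ in $D^{+}(a,R)$ lie in $D^{-}(a,R)$, then there are finitely many of them, and with $Z$ and $P$ the numbers of zeros and of poles of $f$ in $D^{+}(a,R)$, counted with multiplicity, the integral exists and $$\int_{\mathcal{A}(a,b),\Phi_\alpha} \frac{f'(x)}{f(x)}\,dx = Z - P.$$ -/

import Mathlib

namespace PadicArc

/-! ## Path sequences and interlocked families -/

/-- A path sequence: a sequence of positive integers, strictly increasing from some index
`k₀ ≥ 1` on.  The values at indices below `k₀`, where a path sequence need not be defined,
are irrelevant everywhere below. -/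
def IsPathSequence (φ : ℕ → ℕ) : Prop :=
  ∃ k₀ : ℕ, 0 < k₀ ∧ (∀ k, k₀ ≤ k → 0 < φ k) ∧ StrictMonoOn φ (Set.Ici k₀)

/-- `ψ k`, `k ≥ k₀`, is a subsequence of `φ`. -/
def IsSubseqFrom (k₀ : ℕ) (ψ φ : ℕ → ℕ) : Prop :=
  ∃ σ : ℕ → ℕ, StrictMonoOn σ (Set.Ici k₀) ∧ ∀ k, k₀ ≤ k → ψ k = φ (σ k)

/-- An interlocked family of path sequences. -/
structure InterlockedFamily where
  carrier : Set (ℕ → ℕ)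
  nonempty : carrier.Nonempty
  isPathSequence : ∀ φ ∈ carrier, IsPathSequence φ
  interlocked : ∀ φ₁ ∈ carrier, ∀ φ₂ ∈ carrier, ∃ φ₃ ∈ carrier, ∃ k₀ : ℕ, 0 < k₀ ∧
    IsSubseqFrom k₀ φ₃ φ₁ ∧ IsSubseqFrom k₀ φ₃ φ₂

/-- The interlocked family `Φ_α = {k ↦ α + λ k | λ = 1, 2, …}`, for an integer `α ≥ 0`. -/
def Phi (α : ℕ) : InterlockedFamily where
  carrier := {φ | ∃ l : ℕ, 0 < l ∧ ∀ k, φ k = α + l * k}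
  nonempty := ⟨fun k => α + 1 * k, 1, one_pos, fun _ => rfl⟩
  isPathSequence := by
    rintro φ ⟨l, hl, hφ⟩
    refine ⟨1, one_pos, fun k hk => ?_, fun j _ k _ hjk => ?_⟩
    · rw [hφ]
      have := Nat.mul_pos hl hk
      omega
    · rw [hφ, hφ]
      have := Nat.mul_lt_mul_of_pos_left hjk hl
      omega
  interlocked := by
    rintro φ₁ ⟨l₁, h₁, hφ₁⟩ φ₂ ⟨l₂, h₂, hφ₂⟩
    refine ⟨fun k => α + l₁ * l₂ * k, ⟨l₁ * l₂, Nat.mul_pos h₁ h₂, fun _ => rfl⟩, 1, one_pos,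
      ⟨fun k => l₂ * k, fun j _ k _ hjk => Nat.mul_lt_mul_of_pos_left hjk h₂, fun k _ => ?_⟩,
      ⟨fun k => l₁ * k, fun j _ k _ hjk => Nat.mul_lt_mul_of_pos_left hjk h₁, fun k _ => ?_⟩⟩
    · simp only [hφ₁]; ring
    · simp only [hφ₂]; ring

section

variable {p : ℕ} [Fact p.Prime]

/-! ## The line integral on an arc -/

/-- `A_{f,φ}(k) = p^{-φ(k)} ∑_x (x - a) f(x)`, where `x = a + (b - a) ζ` and `ζ` runs through
the `p^{φ(k)}`-th roots of unity in `ℂ_p`. -/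
noncomputable def arcSum (a b : ℂ_[p]) (f : ℂ_[p] → ℂ_[p]) (φ : ℕ → ℕ) (k : ℕ) : ℂ_[p] :=
  ((p : ℂ_[p]) ^ φ k)⁻¹ * ∑ ζ ∈ Polynomial.nthRootsFinset (p ^ φ k) (1 : ℂ_[p]),
    ((a + (b - a) * ζ) - a) * f (a + (b - a) * ζ)

/-- `HasArcIntegral a b Φ f L` : the line integral of `f` on the arc
`𝒜(a,b) = {x | |x - b| < |b - a|}` with respect to the interlocked family `Φ` exists and equals
`L`.  Only the values of `f` on `𝒜(a,b)` enter. -/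
def HasArcIntegral (a b : ℂ_[p]) (Φ : InterlockedFamily) (f : ℂ_[p] → ℂ_[p]) (L : ℂ_[p]) :
    Prop :=
  ∀ ε : ℝ, 0 < ε → ∃ K : ℕ, 0 < K ∧ ∃ φ ∈ Φ.carrier, ∀ k, K < k → ‖arcSum a b f φ k - L‖ < ε

/-- The value of the line integral is unique. -/
theorem HasArcIntegral.unique {a b : ℂ_[p]} {Φ : InterlockedFamily} {f : ℂ_[p] → ℂ_[p]}
    {L₁ L₂ : ℂ_[p]} (h₁ : HasArcIntegral a b Φ f L₁) (h₂ : HasArcIntegral a b Φ f L₂) :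
    L₁ = L₂ := by
  have key : ∀ (k₀ : ℕ) (σ : ℕ → ℕ), StrictMonoOn σ (Set.Ici k₀) → ∀ n, n ≤ σ (k₀ + n) := by
    intro k₀ σ hσ n
    induction n with
    | zero => exact Nat.zero_le _
    | succ n ih =>
      have : σ (k₀ + n) < σ (k₀ + (n + 1)) :=
        hσ (Set.mem_Ici.2 (by omega)) (Set.mem_Ici.2 (by omega)) (by omega)
      omega
  refine eq_of_forall_dist_le fun ε hε => ?_
  obtain ⟨K₁, -, φ₁, hφ₁, H₁⟩ := h₁ (ε / 2) (half_pos hε)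
  obtain ⟨K₂, -, φ₂, hφ₂, H₂⟩ := h₂ (ε / 2) (half_pos hε)
  obtain ⟨φ, -, k₀, -, ⟨σ₁, hσ₁, e₁⟩, ⟨σ₂, hσ₂, e₂⟩⟩ := Φ.interlocked φ₁ hφ₁ φ₂ hφ₂
  set n := K₁ + K₂ + 1 with hn
  have a₁ := H₁ (σ₁ (k₀ + n)) (by have := key k₀ σ₁ hσ₁ n; omega)
  have a₂ := H₂ (σ₂ (k₀ + n)) (by have := key k₀ σ₂ hσ₂ n; omega)
  have E : arcSum a b f φ₁ (σ₁ (k₀ + n)) = arcSum a b f φ₂ (σ₂ (k₀ + n)) := by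
    unfold arcSum
    rw [← e₁ (k₀ + n) (by omega), ← e₂ (k₀ + n) (by omega)]
  rw [E, ← dist_eq_norm] at a₁
  rw [← dist_eq_norm] at a₂
  have := dist_triangle_left L₁ L₂ (arcSum a b f φ₂ (σ₂ (k₀ + n)))
  linarith

/-! ## The Teichmüller character -/

open Classical in
/-- The Teichmüller character on `{|x| ≤ 1}`, extended by `0` to `{|x| < 1}`: for `|x| = 1`,
`ω(x)` is the root of unity `ζ` of order prime to `p` with `|x - ζ| < 1`. -/
noncomputable def teichmuller (x : ℂ_[p]) : ℂ_[p] :=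
  if ‖x‖ < 1 then 0
  else if h : ∃ ζ : ℂ_[p], (∃ n : ℕ, 0 < n ∧ n.Coprime p ∧ ζ ^ n = 1) ∧ ‖x - ζ‖ < 1
    then h.choose else 0

/-! ## Holomorphic and meromorphic functions on a closed disc -/

/-- `f` is holomorphic on the closed disc `D⁺(a,R)`: there it is given by a single convergent
power series. -/
def HolomorphicOnDisc (f : ℂ_[p] → ℂ_[p]) (a : ℂ_[p]) (R : ℝ) : Prop :=
  ∃ c : ℕ → ℂ_[p], ∀ x ∈ Metric.closedBall a R, HasSum (fun n => c n * (x - a) ^ n) (f x)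

/-- `f` is meromorphic on the closed disc `D⁺(a,R)`: it is a quotient `g / h` of holomorphic
functions on the disc with `h` not identically zero.  The last clause says that `f` takes the
correct value at points where `h` vanishes but `f` has no pole; values at poles are arbitrary. -/
def MeromorphicOnDisc (f : ℂ_[p] → ℂ_[p]) (a : ℂ_[p]) (R : ℝ) : Prop :=
  ∃ g h : ℂ_[p] → ℂ_[p], HolomorphicOnDisc g a R ∧ HolomorphicOnDisc h a R ∧
    (∃ x ∈ Metric.closedBall a R, h x ≠ 0) ∧
    (∀ x ∈ Metric.closedBall a R, h x ≠ 0 → f x = g x / h x) ∧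
    (∀ x ∈ Metric.closedBall a R, 0 ≤ meromorphicOrderAt f x → AnalyticAt ℂ_[p] f x)

/-- The set of zeros and poles of `f` in `s`. -/
def zerosAndPoles (f : ℂ_[p] → ℂ_[p]) (s : Set ℂ_[p]) : Set ℂ_[p] :=
  {x ∈ s | meromorphicOrderAt f x ≠ 0}

/-- The number of zeros of `f` in `s`, counted with multiplicity
(when `zerosAndPoles f s` is finite and `f` is not locally zero at a point of `s`). -/
noncomputable def zeroCount (f : ℂ_[p] → ℂ_[p]) (s : Set ℂ_[p]) : ℕ :=
  ∑ᶠ x ∈ s, (meromorphicOrderAt f x).untop₀.toNat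

/-- The number of poles of `f` in `s`, counted with multiplicity
(when `zerosAndPoles f s` is finite). -/
noncomputable def poleCount (f : ℂ_[p] → ℂ_[p]) (s : Set ℂ_[p]) : ℕ :=
  ∑ᶠ x ∈ s, (-(meromorphicOrderAt f x).untop₀).toNat

end

end PadicArc

/-!
The proof works in the coordinate `t` with `x = a + (b - a) t`, in which the disc `D⁺(a,R)` is the
closed unit disc, `b` is the point `1`, and holomorphic functions are restricted power series, that
is, power series whose coefficients tend to zero.

*The divisor.*  A nonzero restricted power series has a Weierstrass degree, the last index at which
its coefficients have maximal norm.  If the degree is positive, the series has a zero in the unit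
disc, because zeros of its truncations form a Cauchy sequence
(`HasWeierstrassDegree.exists_evalTsum_eq_zero`); dividing by `X - r` lowers the degree by one; and
a series of degree `0` is invertible (`HasWeierstrassDegree.isRestrictedUnit`).  Hence every
nonzero restricted power series is a finite product of linear factors times a unit
(`IsRestricted.exists_eq_prod_mul_unit`), and `f` is, up to removable singularities, a rational
function with a finite divisor `D` times a unit.  Its logarithmic derivative is therefore
`∑ r, D r / (t - r)` plus a restricted power series (`MeromorphicOnDisc.exists_divisor`).

*The integral.*  With `N = p ^ φ k`, the mean value of `ζ / (ζ - r)` over the `N`-th roots of unity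
is `1 / (1 - r ^ N)` (`sum_nthRootsFinset_div_sub`).  The mean value of `ζ L(ζ)` for a restricted
power series `L` only involves coefficients of index at least `N - 1`, so it tends to zero
(`tendsto_mean_mul_evalTsum`).  If `r` lies in the residue disc of the Teichmüller representative
`ω`, then `r ^ p ^ n - ω ^ p ^ n` tends to zero (`tendsto_pow_prime_pow_sub_pow`), while
`ω ^ p ^ (α + l * k) = ω ^ p ^ α` as soon as `ω ^ p ^ l = ω`; one `l` serves the finitely many
discs.  So the contribution of `r` tends to `D r / (1 - ω ^ p ^ α)`.

The statement about `D⁻(a,R)` is the case of the single disc around `a`, whose Teichmüller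
representative is `0`.
-/

section

open Filter Topology PowerSeries

/-! ### Restricted power series as functions on the closed unit disc -/

section UnitDisc

variable {K : Type*} [NormedField K] [IsUltrametricDist K]

lemma norm_le_one_of_norm_sub_le {x r : K} (h : ‖x - r‖ ≤ 1) (hr : ‖r‖ ≤ 1) : ‖x‖ ≤ 1 := by
  rw [← sub_add_cancel x r]
  exact (IsUltrametricDist.norm_add_le_max _ _).trans (max_le h hr)

lemma norm_sub_le_one {x y : K} (hx : ‖x‖ ≤ 1) (hy : ‖y‖ ≤ 1) : ‖x - y‖ ≤ 1 := by
  rw [sub_eq_add_neg]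
  exact (IsUltrametricDist.norm_add_le_max _ _).trans (max_le hx (by rwa [norm_neg]))

lemma norm_sub_lt_one_trans {x y z : K} (hxy : ‖x - y‖ < 1) (hyz : ‖y - z‖ < 1) :
    ‖x - z‖ < 1 := by
  rw [← sub_add_sub_cancel x y z]
  exact (IsUltrametricDist.norm_add_le_max _ _).trans_lt (max_lt hxy hyz)

/-- The closed unit disc is open. -/
lemma eventually_norm_le_one {x : K} (hx : ‖x‖ ≤ 1) : ∀ᶠ y in 𝓝 x, ‖y‖ ≤ 1 := by
  filter_upwards [Metric.ball_mem_nhds x one_pos] with y hy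
  exact norm_le_one_of_norm_sub_le (mem_ball_iff_norm.1 hy).le hx

end UnitDisc

namespace PowerSeries

variable {K : Type*} [NontriviallyNormedField K]

/-- The value at `x` of the power series `f`; meaningful when the series converges at `x`, in
particular for restricted `f` and `‖x‖ ≤ 1`. -/
noncomputable def evalTsum (f : K⟦X⟧) (x : K) : K := ∑' n, coeff n f * x ^ n

lemma isRestricted_one_iff {f : K⟦X⟧} :
    IsRestricted 1 f ↔ Tendsto (fun n => coeff n f) atTop (𝓝 0) := by
  simp only [isRestricted_iff', one_pow, mul_one, ← tendsto_zero_iff_norm_tendsto_zero]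

lemma isRestricted_X : IsRestricted 1 (X : K⟦X⟧) := isRestricted_monomial 1 1 1

lemma isRestricted_X_sub_C (r : K) : IsRestricted 1 (X - C r : K⟦X⟧) := by
  rw [sub_eq_add_neg]
  exact isRestricted.add 1 isRestricted_X (isRestricted.neg 1 (isRestricted_C 1 r))

lemma tendsto_coeff_mul_pow {f : K⟦X⟧} (hf : IsRestricted 1 f) {x : K} (hx : ‖x‖ ≤ 1) (k : ℕ) :
    Tendsto (fun n => coeff (k + n) f * x ^ n) cofinite (𝓝 0) := by
  rw [Nat.cofinite_eq_atTop]
  have h := (tendsto_add_atTop_iff_nat k).2 (isRestricted_one_iff.1 hf)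
  refine squeeze_zero_norm (fun n => ?_) (tendsto_zero_iff_norm_tendsto_zero.1 h)
  rw [norm_mul, norm_pow, add_comm k]
  exact mul_le_of_le_one_right (norm_nonneg _) (pow_le_one₀ (norm_nonneg _) hx)

@[simp] lemma evalTsum_C (a x : K) : evalTsum (C a) x = a := by
  rw [evalTsum, tsum_eq_single 0]
  · simp
  · intro n hn
    simp [coeff_C, hn]

@[simp] lemma evalTsum_one (x : K) : evalTsum (1 : K⟦X⟧) x = 1 := evalTsum_C 1 x

@[simp] lemma evalTsum_X (x : K) : evalTsum (X : K⟦X⟧) x = x := by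
  rw [evalTsum, tsum_eq_single 1]
  · simp
  · intro n hn
    simp [coeff_X, hn]

lemma evalTsum_neg (f : K⟦X⟧) (x : K) : evalTsum (-f) x = -evalTsum f x := by
  simp [evalTsum, tsum_neg]

section Ultrametric

variable [IsUltrametricDist K]

lemma norm_evalTsum_le {f : K⟦X⟧} {B : ℝ} (hB : ∀ n, ‖coeff n f‖ ≤ B) {x : K} (hx : ‖x‖ ≤ 1) :
    ‖evalTsum f x‖ ≤ B := by
  refine IsUltrametricDist.norm_tsum_le_of_forall_le (fun n => ?_)
  rw [norm_mul, norm_pow]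
  exact (mul_le_of_le_one_right (norm_nonneg _) (pow_le_one₀ (norm_nonneg _) hx)).trans (hB n)

/-- The quotient of `f - f(r)` by `X - r`, given by its coefficients; these are meaningful for
restricted `f` and `‖r‖ ≤ 1`. -/
noncomputable def divXSubC (f : K⟦X⟧) (r : K) : K⟦X⟧ :=
  mk fun n => ∑' j, coeff (n + 1 + j) f * r ^ j

lemma norm_coeff_divXSubC_le {f : K⟦X⟧} {n : ℕ} {B : ℝ} (hB : ∀ m, n < m → ‖coeff m f‖ ≤ B)
    {r : K} (hr : ‖r‖ ≤ 1) : ‖coeff n (divXSubC f r)‖ ≤ B := by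
  rw [divXSubC, coeff_mk]
  refine IsUltrametricDist.norm_tsum_le_of_forall_le (fun j => ?_)
  rw [norm_mul, norm_pow]
  exact (mul_le_of_le_one_right (norm_nonneg _) (pow_le_one₀ (norm_nonneg _) hr)).trans
    (hB _ (by omega))

lemma IsRestricted.divXSubC {f : K⟦X⟧} (hf : IsRestricted 1 f) {r : K} (hr : ‖r‖ ≤ 1) :
    IsRestricted 1 (divXSubC f r) := by
  rw [isRestricted_one_iff] at hf ⊢
  rw [NormedAddGroup.tendsto_nhds_zero] at hf ⊢
  intro ε hε
  obtain ⟨N, hN⟩ := eventually_atTop.1 (hf (ε / 2) (half_pos hε))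
  refine eventually_atTop.2 ⟨N, fun n hn => ?_⟩
  exact (norm_coeff_divXSubC_le (fun m hm => (hN m (by omega)).le) hr).trans_lt (half_lt_self hε)

lemma tsum_mul_tsum_eq_tsum_sum_antidiagonal_of_ultrametric {f g : ℕ → K} (hf : Summable f)
    (hg : Summable g) :
    (∑' n, f n) * ∑' n, g n = ∑' n, ∑ q ∈ Finset.HasAntidiagonal.antidiagonal n, f q.1 * g q.2 := by
  have : NonarchimedeanRing K := ⟨NonarchimedeanAddGroup.is_nonarchimedean⟩
  have h := hf.mul_of_nonarchimedean hg
  exact hf.tsum_mul_tsum_eq_tsum_sum_antidiagonal hg h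

end Ultrametric

section Complete

variable [IsUltrametricDist K] [CompleteSpace K]

lemma IsRestricted.hasSum {f : K⟦X⟧} (hf : IsRestricted 1 f) {x : K} (hx : ‖x‖ ≤ 1) :
    HasSum (fun n => coeff n f * x ^ n) (evalTsum f x) :=
  (NonarchimedeanAddGroup.summable_of_tendsto_cofinite_zero
    (by simpa using tendsto_coeff_mul_pow hf hx 0)).hasSum

lemma evalTsum_add {f g : K⟦X⟧} (hf : IsRestricted 1 f) (hg : IsRestricted 1 g) {x : K}
    (hx : ‖x‖ ≤ 1) : evalTsum (f + g) x = evalTsum f x + evalTsum g x := by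
  rw [evalTsum, ← ((hf.hasSum hx).add (hg.hasSum hx)).tsum_eq]
  simp only [map_add, add_mul]

lemma evalTsum_X_sub_C (r : K) {x : K} (hx : ‖x‖ ≤ 1) : evalTsum (X - C r) x = x - r := by
  rw [sub_eq_add_neg, evalTsum_add isRestricted_X (isRestricted.neg 1 (isRestricted_C 1 r)) hx,
    evalTsum_neg]
  simp [sub_eq_add_neg]

lemma evalTsum_mul {f g : K⟦X⟧} (hf : IsRestricted 1 f) (hg : IsRestricted 1 g) {x : K}
    (hx : ‖x‖ ≤ 1) : evalTsum (f * g) x = evalTsum f x * evalTsum g x := by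
  rw [evalTsum, evalTsum, evalTsum, tsum_mul_tsum_eq_tsum_sum_antidiagonal_of_ultrametric
    (hf.hasSum hx).summable (hg.hasSum hx).summable]
  refine tsum_congr fun n => ?_
  rw [coeff_mul, Finset.sum_mul]
  refine Finset.sum_congr rfl fun q hq => ?_
  rw [← Finset.HasAntidiagonal.mem_antidiagonal.1 hq, pow_add]
  ring

lemma IsRestricted.coeff_eq_sub {f : K⟦X⟧} (hf : IsRestricted 1 f) {r : K} (hr : ‖r‖ ≤ 1) (n : ℕ) :
    coeff (n + 1) f =
      coeff n (PowerSeries.divXSubC f r) - r * coeff (n + 1) (PowerSeries.divXSubC f r) := by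
  have hs : Summable fun j => coeff (n + 1 + j) f * r ^ j :=
    NonarchimedeanAddGroup.summable_of_tendsto_cofinite_zero (tendsto_coeff_mul_pow hf hr _)
  simp only [PowerSeries.divXSubC, coeff_mk]
  rw [hs.tsum_eq_zero_add, ← tsum_mul_left]
  have : ∀ j, coeff (n + 1 + (j + 1)) f * r ^ (j + 1) = r * (coeff (n + 1 + 1 + j) f * r ^ j) := by
    intro j
    rw [show n + 1 + (j + 1) = n + 1 + 1 + j by omega]
    ring
  simp [this]

/-- Division of a restricted power series by `X - r`, for `r` in the closed unit disc. -/
lemma IsRestricted.eq_C_add_mul_divXSubC {f : K⟦X⟧} (hf : IsRestricted 1 f) {r : K}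
    (hr : ‖r‖ ≤ 1) : f = C (evalTsum f r) + (X - C r) * PowerSeries.divXSubC f r := by
  ext n
  cases n with
  | zero =>
    have := (hf.hasSum hr).summable.tsum_eq_zero_add
    rw [← evalTsum] at this
    have h2 : ∀ j, coeff (j + 1) f * r ^ (j + 1) = r * (coeff (0 + 1 + j) f * r ^ j) := by
      intro j
      rw [show 0 + 1 + j = j + 1 by omega]
      ring
    simp only [h2, tsum_mul_left, pow_zero, mul_one] at this
    rw [this]
    simp [PowerSeries.divXSubC, sub_mul]
  | succ n =>
    rw [hf.coeff_eq_sub hr]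
    simp [sub_mul, coeff_succ_X_mul]

end Complete

/-! ### Analyticity and derivatives -/

lemma IsRestricted.exists_bound {f : K⟦X⟧} (hf : IsRestricted 1 f) :
    ∃ B, ∀ n, ‖coeff n f‖ ≤ B := by
  obtain ⟨B, hB⟩ := (isRestricted_one_iff.1 hf).norm.bddAbove_range
  exact ⟨B, fun n => hB ⟨n, rfl⟩⟩

section Ultrametric

variable [IsUltrametricDist K]

lemma IsRestricted.iterate_divXSubC {f : K⟦X⟧} (hf : IsRestricted 1 f) {r : K} (hr : ‖r‖ ≤ 1)
    (n : ℕ) : IsRestricted 1 ((fun g => PowerSeries.divXSubC g r)^[n] f) := by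
  induction n with
  | zero => exact hf
  | succ n ih => rw [Function.iterate_succ_apply']; exact ih.divXSubC hr

lemma norm_coeff_iterate_divXSubC_le {f : K⟦X⟧} {B : ℝ} (hB : ∀ n, ‖coeff n f‖ ≤ B) {r : K}
    (hr : ‖r‖ ≤ 1) (k n : ℕ) : ‖coeff n ((fun g => PowerSeries.divXSubC g r)^[k] f)‖ ≤ B := by
  induction k generalizing n with
  | zero => exact hB n
  | succ k ih =>
    rw [Function.iterate_succ_apply']
    exact norm_coeff_divXSubC_le (fun m _ => ih m) hr

lemma IsRestricted.derivative {f : K⟦X⟧} (hf : IsRestricted 1 f) :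
    IsRestricted 1 (PowerSeries.derivative K f) := by
  rw [isRestricted_one_iff] at hf ⊢
  have h := ((tendsto_add_atTop_iff_nat 1).2 hf).norm
  rw [norm_zero] at h
  refine squeeze_zero_norm (fun n => ?_) h
  rw [coeff_derivative, norm_mul]
  refine mul_le_of_le_one_right (norm_nonneg _) ?_
  exact_mod_cast IsUltrametricDist.norm_natCast_le_one K (n + 1)

end Ultrametric

section Complete

variable [IsUltrametricDist K] [CompleteSpace K]

lemma IsRestricted.evalTsum_eq {f : K⟦X⟧} (hf : IsRestricted 1 f) {r x : K} (hr : ‖r‖ ≤ 1)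
    (hx : ‖x‖ ≤ 1) :
    evalTsum f x = evalTsum f r + (x - r) * evalTsum (PowerSeries.divXSubC f r) x := by
  conv_lhs => rw [hf.eq_C_add_mul_divXSubC hr]
  rw [evalTsum_add (isRestricted_C 1 _)
    (isRestricted.mul 1 (isRestricted_X_sub_C r) (hf.divXSubC hr)) hx,
    evalTsum_mul (isRestricted_X_sub_C r) (hf.divXSubC hr) hx, evalTsum_X_sub_C r hx, evalTsum_C]

/-- A restricted power series is analytic at every point of the closed unit disc, the boundary
included: iterated division by `X - r` gives the Taylor expansion at `r`. -/
lemma IsRestricted.analyticAt {f : K⟦X⟧} (hf : IsRestricted 1 f) {r : K} (hr : ‖r‖ ≤ 1) :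
    AnalyticAt K (evalTsum f) r := by
  obtain ⟨B, hB⟩ := hf.exists_bound
  set F : ℕ → K⟦X⟧ := fun n => (fun g => PowerSeries.divXSubC g r)^[n] f with hF
  have hFr : ∀ n, IsRestricted 1 (F n) := hf.iterate_divXSubC hr
  have hFB : ∀ k n, ‖coeff n (F k)‖ ≤ B := norm_coeff_iterate_divXSubC_le hB hr
  refine ⟨FormalMultilinearSeries.ofScalars K fun n => evalTsum (F n) r, ?_⟩
  rw [hasFPowerSeriesAt_iff']
  filter_upwards [Metric.ball_mem_nhds r one_pos] with x hx
  rw [mem_ball_iff_norm] at hx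
  have hx1 : ‖x‖ ≤ 1 := norm_le_one_of_norm_sub_le hx.le hr
  have h0 : Tendsto (fun n => ‖x - r‖ ^ n * B) atTop (𝓝 0) := by
    simpa using (tendsto_pow_atTop_nhds_zero_of_lt_one (norm_nonneg _) hx).mul_const B
  have hpart : ∀ n, evalTsum f x =
      ∑ k ∈ Finset.range n, (x - r) ^ k * evalTsum (F k) r + (x - r) ^ n * evalTsum (F n) x := by
    intro n
    induction n with
    | zero => simp [hF]
    | succ n ih =>
      have : F (n + 1) = PowerSeries.divXSubC (F n) r := by
        simp only [hF, Function.iterate_succ_apply']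
      rw [Finset.sum_range_succ, this, ih, (hFr n).evalTsum_eq hr hx1]
      ring
  have hs : Summable fun n => (x - r) ^ n * evalTsum (F n) r := by
    refine NonarchimedeanAddGroup.summable_of_tendsto_cofinite_zero ?_
    rw [Nat.cofinite_eq_atTop]
    refine squeeze_zero_norm (fun n => ?_) h0
    rw [norm_mul, norm_pow]
    gcongr
    exact norm_evalTsum_le (hFB n) hr
  simp only [FormalMultilinearSeries.coeff_ofScalars, smul_eq_mul]
  rw [hs.hasSum_iff_tendsto_nat]
  have h1 : Tendsto (fun n => (x - r) ^ n * evalTsum (F n) x) atTop (𝓝 0) := by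
    refine squeeze_zero_norm (fun n => ?_) h0
    rw [norm_mul, norm_pow]
    gcongr
    exact norm_evalTsum_le (hFB n) hx1
  have h2 := (tendsto_const_nhds (x := evalTsum f x)).sub h1
  rw [sub_zero] at h2
  refine h2.congr fun n => ?_
  rw [hpart n, add_sub_cancel_right]

lemma IsRestricted.deriv_evalTsum {f : K⟦X⟧} (hf : IsRestricted 1 f) {r : K} (hr : ‖r‖ ≤ 1) :
    deriv (evalTsum f) r = evalTsum (PowerSeries.derivative K f) r := by
  have hq := hf.divXSubC hr
  have h1 : evalTsum f =ᶠ[𝓝 r] fun x =>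
      evalTsum f r + (x - r) * evalTsum (PowerSeries.divXSubC f r) x := by
    filter_upwards [eventually_norm_le_one hr] with x hx
    exact hf.evalTsum_eq hr hx
  have h2 : HasDerivAt (fun x => evalTsum f r + (x - r) * evalTsum (PowerSeries.divXSubC f r) x)
      (evalTsum (PowerSeries.divXSubC f r) r) r := by
    have := (((hasDerivAt_id r).sub_const r).mul
      (hq.analyticAt hr).differentiableAt.hasDerivAt).const_add (evalTsum f r)
    simpa using this
  rw [h1.deriv_eq, h2.deriv]
  conv_rhs => rw [hf.eq_C_add_mul_divXSubC hr]
  have hX := isRestricted_X_sub_C r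
  have hd : PowerSeries.derivative K (C (evalTsum f r) + (X - C r) * PowerSeries.divXSubC f r) =
      (X - C r) * PowerSeries.derivative K (PowerSeries.divXSubC f r) +
        PowerSeries.divXSubC f r := by
    rw [map_add, Derivation.leibniz, map_sub, derivative_C, derivative_C, derivative_X]
    simp [smul_eq_mul]
  rw [hd, evalTsum_add (isRestricted.mul 1 hX hq.derivative) hq hr,
    evalTsum_mul hX hq.derivative hr, evalTsum_X_sub_C r hr]
  simp

end Complete

end PowerSeries

/-! ### Weierstrass degree and the existence of zeros -/

/-- A real sequence with nonnegative values that tends to zero attains its maximum. -/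
lemma exists_forall_le_of_tendsto_zero {u : ℕ → ℝ} (hu : Tendsto u atTop (𝓝 0))
    (h0 : ∀ n, 0 ≤ u n) : ∃ m, ∀ n, u n ≤ u m := by
  by_cases h : ∃ k, 0 < u k
  · obtain ⟨k, hk⟩ := h
    obtain ⟨N, hN⟩ := eventually_atTop.1 (hu.eventually_lt_const hk)
    obtain ⟨m, -, hm⟩ := Finset.exists_max_image (Finset.range (N + k + 1)) u ⟨0, by simp⟩
    refine ⟨m, fun n => ?_⟩
    by_cases hn : n < N + k + 1
    · exact hm n (by simpa using hn)
    · exact (hN n (by omega)).le.trans (hm k (by simp))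
  · push Not at h
    exact ⟨0, fun n => (h n).trans (h0 0)⟩

namespace Polynomial

variable {K : Type*} [NormedField K] [IsUltrametricDist K]

/-- If all zeros of a polynomial have norm at least `δ`, then its value at `0` controls all of its
coefficients. -/
lemma norm_coeff_mul_pow_le_of_le_norm_roots {δ : ℝ} (hδ : 0 ≤ δ) (s : Multiset K)
    (hs : ∀ a ∈ s, δ ≤ ‖a‖) (m : ℕ) :
    ‖(s.map fun a => X - C a).prod.coeff m‖ * δ ^ m ≤ ‖(s.map fun a => X - C a).prod.coeff 0‖ := by
  induction s using Multiset.induction_on generalizing m with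
  | empty => cases m <;> simp [coeff_one]
  | cons a s ih =>
    have ha := hs a (Multiset.mem_cons_self a s)
    specialize ih fun b hb => hs b (Multiset.mem_cons_of_mem hb)
    rw [Multiset.map_cons, Multiset.prod_cons]
    set P := (s.map fun a => X - C a).prod
    cases m with
    | zero => simp
    | succ m =>
      have h0 : ‖((X - C a) * P).coeff 0‖ = ‖a‖ * ‖P.coeff 0‖ := by
        simp [sub_mul]
      have h1 : ‖((X - C a) * P).coeff (m + 1)‖ ≤ max ‖P.coeff m‖ (‖a‖ * ‖P.coeff (m + 1)‖) := by
        rw [sub_mul, coeff_sub, coeff_X_mul, coeff_C_mul, ← norm_mul, sub_eq_add_neg,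
          ← norm_neg (a * _)]
        exact IsUltrametricDist.norm_add_le_max _ _
      rw [h0]
      refine (mul_le_mul_of_nonneg_right h1 (by positivity)).trans ?_
      rw [max_mul_of_nonneg _ _ (by positivity)]
      refine max_le ?_ ?_
      · calc ‖P.coeff m‖ * δ ^ (m + 1) = δ * (‖P.coeff m‖ * δ ^ m) := by ring
          _ ≤ ‖a‖ * ‖P.coeff 0‖ := mul_le_mul ha (ih m) (by positivity) (norm_nonneg _)
      · rw [mul_assoc]
        exact mul_le_mul_of_nonneg_left (ih (m + 1)) (norm_nonneg _)

end Polynomial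

namespace PowerSeries

variable {K : Type*} [NontriviallyNormedField K]

/-- The Weierstrass degree of `f` (for the closed unit disc) is `m`: the coefficients of `f` have
maximal norm at `m`, and at no index above `m`. -/
def HasWeierstrassDegree (f : K⟦X⟧) (m : ℕ) : Prop :=
  (∀ n, ‖coeff n f‖ ≤ ‖coeff m f‖) ∧ ∀ n, m < n → ‖coeff n f‖ < ‖coeff m f‖

lemma HasWeierstrassDegree.norm_coeff_pos {f : K⟦X⟧} {m : ℕ} (h : HasWeierstrassDegree f m) :
    0 < ‖coeff m f‖ :=
  (norm_nonneg _).trans_lt (h.2 (m + 1) (Nat.lt_succ_self m))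

lemma IsRestricted.exists_hasWeierstrassDegree {f : K⟦X⟧} (hf : IsRestricted 1 f) (h0 : f ≠ 0) :
    ∃ m, HasWeierstrassDegree f m := by
  have hf' := (isRestricted_one_iff.1 hf).norm
  rw [norm_zero] at hf'
  obtain ⟨k, hk⟩ := exists_forall_le_of_tendsto_zero hf' fun _ => norm_nonneg _
  have hpos : 0 < ‖coeff k f‖ := by
    obtain ⟨n, hn⟩ := (exists_coeff_ne_zero_iff_ne_zero).2 h0
    exact (norm_pos_iff.2 hn).trans_le (hk n)
  obtain ⟨N, hN⟩ := eventually_atTop.1 (hf'.eventually_lt_const hpos)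
  classical
  have hb : ∀ n, ‖coeff n f‖ = ‖coeff k f‖ → n ≤ N := fun n hn => by
    by_contra! h
    exact (hN n h.le).ne hn
  have hsp := Nat.findGreatest_spec (P := fun n => ‖coeff n f‖ = ‖coeff k f‖) (hb k rfl) rfl
  refine ⟨Nat.findGreatest (fun n => ‖coeff n f‖ = ‖coeff k f‖) N, fun n => ?_, fun n hn => ?_⟩
  · rw [hsp]
    exact hk n
  · rw [hsp]
    refine (hk n).lt_of_ne fun h => ?_
    have := Nat.le_findGreatest (P := fun n => ‖coeff n f‖ = ‖coeff k f‖) (hb n h) h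
    omega

/-- A strict bound on the coefficients beyond `m` can be improved uniformly. -/
lemma IsRestricted.exists_bound_lt {f : K⟦X⟧} (hf : IsRestricted 1 f) {m : ℕ} {B : ℝ}
    (h : ∀ n, m < n → ‖coeff n f‖ < B) : ∃ B' < B, ∀ n, m < n → ‖coeff n f‖ ≤ B' := by
  have hf' := ((tendsto_add_atTop_iff_nat (m + 1)).2 (isRestricted_one_iff.1 hf)).norm
  rw [norm_zero] at hf'
  obtain ⟨k, hk⟩ := exists_forall_le_of_tendsto_zero hf' fun _ => norm_nonneg _
  refine ⟨_, h (k + (m + 1)) (by omega), fun n hn => ?_⟩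
  have := hk (n - (m + 1))
  rwa [Nat.sub_add_cancel hn] at this

lemma isRestricted_coe (P : Polynomial K) : IsRestricted 1 (P : K⟦X⟧) := by
  rw [isRestricted_one_iff]
  refine tendsto_const_nhds.congr' ?_
  filter_upwards [eventually_gt_atTop P.natDegree] with n hn
  rw [Polynomial.coeff_coe, Polynomial.coeff_eq_zero_of_natDegree_lt hn]

lemma evalTsum_coe (P : Polynomial K) (x : K) : evalTsum (P : K⟦X⟧) x = P.eval x := by
  rw [evalTsum, Polynomial.eval_eq_sum_range,
    tsum_eq_sum (s := Finset.range (P.natDegree + 1))]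
  · simp
  · intro n hn
    rw [Polynomial.coeff_coe, Polynomial.coeff_eq_zero_of_natDegree_lt (by simpa using hn),
      zero_mul]

section Ultrametric

variable [IsUltrametricDist K]

/-- Division by `X - r` lowers the Weierstrass degree by one. -/
lemma HasWeierstrassDegree.divXSubC {f : K⟦X⟧} {m : ℕ} (h : HasWeierstrassDegree f (m + 1))
    (hf : IsRestricted 1 f) {r : K} (hr : ‖r‖ ≤ 1) [CompleteSpace K] :
    HasWeierstrassDegree (PowerSeries.divXSubC f r) m := by
  obtain ⟨B, hB, hfB⟩ := hf.exists_bound_lt h.2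
  have hlt : ∀ n, m < n → ‖coeff n (PowerSeries.divXSubC f r)‖ < ‖coeff (m + 1) f‖ := fun n hn =>
    (norm_coeff_divXSubC_le (fun k hk => hfB k (by omega)) hr).trans_lt hB
  have hm : ‖coeff m (PowerSeries.divXSubC f r)‖ = ‖coeff (m + 1) f‖ := by
    have h1 := hf.coeff_eq_sub hr m
    have h2 : ‖r * coeff (m + 1) (PowerSeries.divXSubC f r)‖ < ‖coeff (m + 1) f‖ := by
      rw [norm_mul]
      exact (mul_le_of_le_one_left (norm_nonneg _) hr).trans_lt (hlt _ (Nat.lt_succ_self m))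
    rw [eq_sub_iff_add_eq] at h1
    rw [← h1, IsUltrametricDist.norm_add_eq_max_of_norm_ne_norm h2.ne', max_eq_left h2.le]
  exact ⟨fun n => hm ▸ norm_coeff_divXSubC_le (fun k _ => h.1 k) hr, fun n hn => hm ▸ hlt n hn⟩

variable [CompleteSpace K]

/-- A series of Weierstrass degree `0` has constant norm, hence no zeros, on the closed unit
disc. -/
lemma HasWeierstrassDegree.norm_evalTsum {f : K⟦X⟧} (h : HasWeierstrassDegree f 0)
    (hf : IsRestricted 1 f) {x : K} (hx : ‖x‖ ≤ 1) : ‖evalTsum f x‖ = ‖coeff 0 f‖ := by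
  obtain ⟨B, hB, hfB⟩ := hf.exists_bound_lt h.2
  have hB0 : 0 ≤ B := (norm_nonneg _).trans (hfB 1 one_pos)
  have hC := isRestricted_C 1 (coeff 0 f)
  have h1 : ‖evalTsum (f + -C (coeff 0 f)) x‖ ≤ B := by
    refine norm_evalTsum_le (fun n => ?_) hx
    cases n with
    | zero => simpa using hB0
    | succ n => simpa using hfB (n + 1) (Nat.succ_pos n)
  rw [evalTsum_add hf (isRestricted.neg 1 hC) hx, evalTsum_neg, evalTsum_C] at h1
  have h2 : evalTsum f x = coeff 0 f + (evalTsum f x + -coeff 0 f) := by ring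
  have h3 := h1.trans_lt hB
  rw [h2, IsUltrametricDist.norm_add_eq_max_of_norm_ne_norm h3.ne', max_eq_left h3.le]

/-- Translation by a point of the closed unit disc does not change the norm of the dominant
coefficient. -/
lemma norm_coeff_taylor {P : Polynomial K} {m : ℕ} (h : HasWeierstrassDegree (P : K⟦X⟧) m)
    {x : K} (hx : ‖x‖ ≤ 1) : ‖(Polynomial.taylor x P).coeff m‖ = ‖P.coeff m‖ := by
  have h0 : ‖(Polynomial.hasseDeriv m P).coeff 0‖ = ‖P.coeff m‖ := by
    simp [Polynomial.hasseDeriv_coeff]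
  have hw : HasWeierstrassDegree (Polynomial.hasseDeriv m P : K⟦X⟧) 0 := by
    have : ∀ n, 0 < n → ‖coeff n (Polynomial.hasseDeriv m P : K⟦X⟧)‖ <
        ‖coeff 0 (Polynomial.hasseDeriv m P : K⟦X⟧)‖ := by
      intro n hn
      rw [Polynomial.coeff_coe, Polynomial.coeff_coe, h0, Polynomial.hasseDeriv_coeff, norm_mul]
      refine (mul_le_of_le_one_left (norm_nonneg _)
        (IsUltrametricDist.norm_natCast_le_one K _)).trans_lt ?_
      simpa using h.2 (n + m) (by omega)
    refine ⟨fun n => ?_, this⟩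
    rcases Nat.eq_zero_or_pos n with rfl | hn
    · exact le_rfl
    · exact (this n hn).le
  rw [Polynomial.taylor_coeff, ← evalTsum_coe, hw.norm_evalTsum (isRestricted_coe _) hx,
    Polynomial.coeff_coe, h0]

/-- A polynomial of positive Weierstrass degree that is small at a point `x` of the closed unit
disc has a zero close to `x`. -/
lemma exists_isRoot_norm_sub_pow_le [IsAlgClosed K] {P : Polynomial K} {m : ℕ} (hm : m ≠ 0)
    (h : HasWeierstrassDegree (P : K⟦X⟧) m) {x : K} (hx : ‖x‖ ≤ 1) :
    ∃ r, P.eval r = 0 ∧ ‖P.coeff m‖ * ‖r - x‖ ^ m ≤ ‖P.eval x‖ := by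
  classical
  set Q := Polynomial.taylor x P with hQ
  have hQm : ‖Q.coeff m‖ = ‖P.coeff m‖ := norm_coeff_taylor h hx
  have hQm0 : Q.coeff m ≠ 0 := by
    rw [← norm_pos_iff, hQm]
    simpa using h.norm_coeff_pos
  have hsplit := IsAlgClosed.splits Q
  have hdeg : Q.natDegree ≠ 0 := fun h0 =>
    hQm0 (Polynomial.coeff_eq_zero_of_natDegree_lt (by omega))
  have hne : Q.roots.toFinset.Nonempty := by
    rw [Multiset.toFinset_nonempty, ← Multiset.card_pos, ← hsplit.natDegree_eq_card_roots]
    omega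
  obtain ⟨s, hs, hmin⟩ := Finset.exists_min_image Q.roots.toFinset norm hne
  have hQs : Q.eval s = 0 := by
    rw [Multiset.mem_toFinset] at hs
    exact (Polynomial.mem_roots'.1 hs).2
  refine ⟨s + x, by simpa [hQ, Polynomial.taylor_eval] using hQs, ?_⟩
  have key := Polynomial.norm_coeff_mul_pow_le_of_le_norm_roots (norm_nonneg s) Q.roots
    (fun a ha => hmin a (by simpa using ha)) m
  have heq := hsplit.eq_prod_roots
  have hc : ∀ n, ‖Q.coeff n‖ =
      ‖Q.leadingCoeff‖ * ‖(Q.roots.map fun a => Polynomial.X - Polynomial.C a).prod.coeff n‖ := by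
    intro n
    conv_lhs => rw [heq]
    rw [Polynomial.coeff_C_mul, norm_mul]
  have hx0 : P.eval x = Q.coeff 0 := by rw [hQ, Polynomial.taylor_coeff_zero]
  rw [add_sub_cancel_right, ← hQm, hx0, hc, hc, mul_assoc]
  exact mul_le_mul_of_nonneg_left key (norm_nonneg _)

/-- A restricted power series of positive Weierstrass degree over an algebraically closed field
has a zero in the closed unit disc, namely the limit of suitable zeros of its truncations. -/
lemma HasWeierstrassDegree.exists_evalTsum_eq_zero [IsAlgClosed K] {f : K⟦X⟧} {m : ℕ}
    (h : HasWeierstrassDegree f m) (hf : IsRestricted 1 f) (hm : m ≠ 0) :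
    ∃ r, ‖r‖ ≤ 1 ∧ evalTsum f r = 0 := by
  have hc := h.norm_coeff_pos
  -- all these truncations have the dominant coefficient of `f`, hence Weierstrass degree `m`
  set Q : ℕ → Polynomial K := fun j => trunc (m + 1 + j) f with hQ
  have hQc : ∀ j n, (Q j).coeff n = if n < m + 1 + j then coeff n f else 0 := fun j n => by
    rw [hQ, coeff_trunc]
  have hQm : ∀ j, (Q j).coeff m = coeff m f := fun j => by rw [hQc, if_pos (by omega)]
  have hQle : ∀ j n, ‖(Q j).coeff n‖ ≤ ‖coeff n f‖ := fun j n => by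
    rw [hQc]; split_ifs <;> simp
  have hQw : ∀ j, HasWeierstrassDegree (Q j : K⟦X⟧) m := fun j => by
    refine ⟨fun n => ?_, fun n hn => ?_⟩
    · rw [Polynomial.coeff_coe, Polynomial.coeff_coe, hQm]
      exact (hQle j n).trans (h.1 n)
    · rw [Polynomial.coeff_coe, Polynomial.coeff_coe, hQm]
      exact (hQle j n).trans_lt (h.2 n hn)
  have hstep : ∀ (j : ℕ) (x : Metric.closedBall (0 : K) 1), ∃ r : Metric.closedBall (0 : K) 1,
      (Q j).eval (r : K) = 0 ∧
        ‖coeff m f‖ * ‖(r : K) - x‖ ^ m ≤ ‖(Q j).eval (x : K)‖ := by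
    rintro j ⟨x, hx⟩
    rw [mem_closedBall_zero_iff] at hx
    obtain ⟨r, hr0, hr⟩ := exists_isRoot_norm_sub_pow_le hm (hQw j) hx
    rw [hQm] at hr
    have h1 : ‖(Q j).eval x‖ ≤ ‖coeff m f‖ := by
      rw [← evalTsum_coe]
      exact norm_evalTsum_le (fun n => by simpa using (hQle j n).trans (h.1 n)) hx
    have h2 : ‖r - x‖ ≤ 1 := by
      by_contra! hlt
      have := one_lt_pow₀ hlt hm
      nlinarith
    exact ⟨⟨r, mem_closedBall_zero_iff.2 (norm_le_one_of_norm_sub_le h2 hx)⟩, hr0, hr⟩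
  choose ρ hρ0 hρ using hstep
  -- `u (j + 1)` is a zero of `Q (j + 1)` close to the zero `u j` of `Q j`
  set u : ℕ → Metric.closedBall (0 : K) 1 :=
    fun j => Nat.rec (ρ 0 ⟨0, by simp⟩) (fun i x => ρ (i + 1) x) j with hu
  have hu0 : ∀ j, (Q j).eval (u j : K) = 0 := fun j => by
    cases j <;> exact hρ0 _ _
  have hunorm : ∀ j, ‖(u j : K)‖ ≤ 1 := fun j => mem_closedBall_zero_iff.1 (u j).2
  have hf' := (isRestricted_one_iff.1 hf).norm
  rw [norm_zero] at hf'
  have hdiff : ∀ j, ‖coeff m f‖ * ‖(u (j + 1) : K) - u j‖ ^ m ≤ ‖coeff (m + 1 + j) f‖ := by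
    intro j
    refine (hρ (j + 1) (u j)).trans ?_
    have : Q (j + 1) = Q j + Polynomial.monomial (m + 1 + j) (coeff (m + 1 + j) f) :=
      trunc_succ f (m + 1 + j)
    rw [this, Polynomial.eval_add, hu0, zero_add, Polynomial.eval_monomial, norm_mul, norm_pow]
    exact mul_le_of_le_one_right (norm_nonneg _) (pow_le_one₀ (norm_nonneg _) (hunorm j))
  have hcauchy : CauchySeq fun j => (u j : K) := by
    refine NonarchimedeanAddGroup.cauchySeq_of_tendsto_sub_nhds_zero ?_
    rw [NormedAddGroup.tendsto_nhds_zero]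
    intro ε hε
    have hsh := (tendsto_add_atTop_iff_nat (m + 1)).2 hf'
    filter_upwards [hsh.eventually_lt_const (show 0 < ‖coeff m f‖ * ε ^ m by positivity)] with j hj
    have h3 := (hdiff j).trans_lt (by rwa [add_comm] at hj)
    exact lt_of_pow_lt_pow_left₀ m hε.le (lt_of_mul_lt_mul_left h3 hc.le)
  obtain ⟨r, hr⟩ := cauchySeq_tendsto_of_complete hcauchy
  have hr1 : ‖r‖ ≤ 1 := le_of_tendsto' hr.norm hunorm
  refine ⟨r, hr1, ?_⟩
  refine tendsto_nhds_unique (((hf.analyticAt hr1).continuousAt.tendsto).comp hr) ?_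
  rw [NormedAddGroup.tendsto_nhds_zero]
  intro ε hε
  obtain ⟨N, hN⟩ := eventually_atTop.1 (hf'.eventually_lt_const (half_pos hε))
  filter_upwards [eventually_ge_atTop N] with j hj
  have hsub : evalTsum f (u j) = evalTsum (f + -(Q j : K⟦X⟧)) (u j) := by
    rw [evalTsum_add hf (isRestricted.neg 1 (isRestricted_coe _)) (hunorm j), evalTsum_neg,
      evalTsum_coe, hu0]
    simp
  rw [Function.comp_apply, hsub]
  refine (norm_evalTsum_le (B := ε / 2) (fun n => ?_) (hunorm j)).trans_lt (half_lt_self hε)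
  rw [map_add, map_neg, Polynomial.coeff_coe, hQc]
  split_ifs with hn
  · simpa using (half_pos hε).le
  · simpa using (hN n (by omega)).le

end Ultrametric

/-! ### Units and factorization of restricted power series -/

/-- `f` is a unit of the ring of restricted power series. -/
def IsRestrictedUnit (f : K⟦X⟧) : Prop :=
  IsRestricted 1 f ∧ constantCoeff f ≠ 0 ∧ IsRestricted 1 f⁻¹

lemma IsRestrictedUnit.mul_inv_cancel {f : K⟦X⟧} (hf : IsRestrictedUnit f) : f * f⁻¹ = 1 :=
  PowerSeries.mul_inv_cancel f hf.2.1

lemma IsRestrictedUnit.inv {f : K⟦X⟧} (hf : IsRestrictedUnit f) : IsRestrictedUnit f⁻¹ := by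
  have h0 : constantCoeff f⁻¹ ≠ 0 := by
    rw [constantCoeff_inv]
    exact inv_ne_zero hf.2.1
  refine ⟨hf.2.2, h0, ?_⟩
  rw [(inv_eq_iff_mul_eq_one h0).2 hf.mul_inv_cancel]
  exact hf.1

section Ultrametric

variable [IsUltrametricDist K]

lemma IsRestrictedUnit.mul {f g : K⟦X⟧} (hf : IsRestrictedUnit f) (hg : IsRestrictedUnit g) :
    IsRestrictedUnit (f * g) := by
  refine ⟨isRestricted.mul 1 hf.1 hg.1, ?_, ?_⟩
  · rw [map_mul]
    exact mul_ne_zero hf.2.1 hg.2.1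
  · rw [PowerSeries.mul_inv_rev]
    exact isRestricted.mul 1 hg.2.2 hf.2.2

lemma norm_coeff_inv_le {f : K⟦X⟧} {n : ℕ} (hn : n ≠ 0) {D : ℝ} (hD : 0 ≤ D)
    (h : ∀ i j, i + j = n → j < n → ‖coeff i f‖ * ‖coeff j f⁻¹‖ ≤ D) :
    ‖coeff n f⁻¹‖ ≤ ‖constantCoeff f‖⁻¹ * D := by
  rw [coeff_inv, if_neg hn, norm_mul, norm_neg, norm_inv]
  refine mul_le_mul_of_nonneg_left ?_ (by positivity)
  refine IsUltrametricDist.norm_sum_le_of_forall_le_of_nonneg hD fun q hq => ?_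
  split_ifs with hlt
  · rw [norm_mul]
    exact h _ _ (Finset.HasAntidiagonal.mem_antidiagonal.1 hq) hlt
  · simpa using hD

/-- A restricted power series of Weierstrass degree `0` has a restricted inverse. -/
lemma HasWeierstrassDegree.isRestrictedUnit {f : K⟦X⟧} (h : HasWeierstrassDegree f 0)
    (hf : IsRestricted 1 f) : IsRestrictedUnit f := by
  have hc : 0 < ‖constantCoeff f‖ := by simpa using h.norm_coeff_pos
  refine ⟨hf, norm_pos_iff.1 hc, ?_⟩
  obtain ⟨B, hB, hfB⟩ := hf.exists_bound_lt h.2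
  rw [coeff_zero_eq_constantCoeff_apply] at hB
  set c := ‖constantCoeff f‖ with hcdef
  -- `ρ < 1` bounds the nonconstant coefficients of `f` relative to the constant one
  obtain ⟨ρ, hρ0, hρ1, hρ⟩ : ∃ ρ : ℝ, 0 < ρ ∧ ρ < 1 ∧ ∀ n, 0 < n → ‖coeff n f‖ ≤ ρ * c := by
    have hB0 : 0 ≤ B := (norm_nonneg _).trans (hfB 1 one_pos)
    refine ⟨(B + c) / (2 * c), by positivity, ?_, fun n hn => (hfB n hn).trans ?_⟩
    · rw [div_lt_one (by positivity)]
      linarith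
    · field_simp
      linarith
  have hcle : ∀ n, ‖coeff n f‖ ≤ c := fun n => by
    simpa using h.1 n
  have hbd : ∀ n, ‖coeff n f⁻¹‖ ≤ c⁻¹ := by
    intro n
    induction n using Nat.strong_induction_on with
    | _ n ih =>
      rcases eq_or_ne n 0 with rfl | hn
      · simp [hcdef]
      · refine (norm_coeff_inv_le hn zero_le_one fun i j _ hj => ?_).trans_eq (mul_one _)
        calc ‖coeff i f‖ * ‖coeff j f⁻¹‖ ≤ c * c⁻¹ :=
              mul_le_mul (hcle i) (ih j hj) (norm_nonneg _) hc.le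
          _ = 1 := mul_inv_cancel₀ hc.ne'
  -- in the recursion for the coefficients of `f⁻¹`, each term has a factor at most `ρ * c`, or one
  -- that is as small as desired
  have hk : ∀ k : ℕ, ∀ᶠ n in atTop, ‖coeff n f⁻¹‖ ≤ c⁻¹ * ρ ^ k := by
    intro k
    induction k with
    | zero => exact Eventually.of_forall fun n => by simpa using hbd n
    | succ k ih =>
      have hf' := (isRestricted_one_iff.1 hf).norm
      rw [norm_zero] at hf'
      obtain ⟨N, hN⟩ := eventually_atTop.1 ih
      obtain ⟨I, hI⟩ := eventually_atTop.1
        (hf'.eventually_lt_const (show 0 < c * ρ ^ (k + 1) by positivity))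
      filter_upwards [eventually_ge_atTop (N + I + 1)] with n hn
      refine norm_coeff_inv_le (by omega) (by positivity) fun i j hij hj => ?_
      rcases le_or_gt I i with hi | hi
      · calc ‖coeff i f‖ * ‖coeff j f⁻¹‖ ≤ (c * ρ ^ (k + 1)) * c⁻¹ :=
              mul_le_mul (hI i hi).le (hbd j) (norm_nonneg _) (by positivity)
          _ = ρ ^ (k + 1) := by field_simp
      · calc ‖coeff i f‖ * ‖coeff j f⁻¹‖ ≤ (ρ * c) * (c⁻¹ * ρ ^ k) :=
              mul_le_mul (hρ i (by omega)) (hN j (by omega)) (norm_nonneg _) (by positivity)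
          _ = ρ ^ (k + 1) := by field_simp; ring
  rw [isRestricted_one_iff, NormedAddGroup.tendsto_nhds_zero]
  intro ε hε
  obtain ⟨k, hk'⟩ := exists_pow_lt_of_lt_one (show 0 < c * ε by positivity) hρ1
  filter_upwards [hk k] with n hn
  refine hn.trans_lt ?_
  rwa [inv_mul_lt_iff₀ hc]

section Complete

variable [CompleteSpace K]

lemma IsRestrictedUnit.evalTsum_mul_inv {f : K⟦X⟧} (hf : IsRestrictedUnit f) {x : K}
    (hx : ‖x‖ ≤ 1) : evalTsum f x * evalTsum f⁻¹ x = 1 := by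
  rw [← evalTsum_mul hf.1 hf.2.2 hx, hf.mul_inv_cancel, evalTsum_one]

lemma IsRestrictedUnit.evalTsum_ne_zero {f : K⟦X⟧} (hf : IsRestrictedUnit f) {x : K}
    (hx : ‖x‖ ≤ 1) : evalTsum f x ≠ 0 :=
  left_ne_zero_of_mul_eq_one (hf.evalTsum_mul_inv hx)

lemma IsRestrictedUnit.logDeriv_evalTsum {f : K⟦X⟧} (hf : IsRestrictedUnit f) {x : K}
    (hx : ‖x‖ ≤ 1) :
    logDeriv (evalTsum f) x = evalTsum (PowerSeries.derivative K f * f⁻¹) x := by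
  rw [logDeriv_apply, hf.1.deriv_evalTsum hx, evalTsum_mul hf.1.derivative hf.2.2 hx,
    div_eq_mul_inv, eq_inv_of_mul_eq_one_right (hf.evalTsum_mul_inv hx)]

/-- A nonzero restricted power series over an algebraically closed field is the product of linear
factors with zeros in the closed unit disc and a unit: the weak form of Weierstrass preparation
obtained by splitting off one zero at a time. -/
lemma IsRestricted.exists_eq_prod_mul_unit [IsAlgClosed K] {f : K⟦X⟧} (hf : IsRestricted 1 f)
    (h0 : f ≠ 0) : ∃ (s : Multiset K) (u : K⟦X⟧), (∀ r ∈ s, ‖r‖ ≤ 1) ∧ IsRestrictedUnit u ∧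
      ∀ x, ‖x‖ ≤ 1 → evalTsum f x = (s.map fun r => x - r).prod * evalTsum u x := by
  obtain ⟨m, hm⟩ := hf.exists_hasWeierstrassDegree h0
  clear h0
  induction m generalizing f with
  | zero => exact ⟨0, f, by simp, hm.isRestrictedUnit hf, by simp⟩
  | succ m ih =>
    obtain ⟨r, hr, hr0⟩ := hm.exists_evalTsum_eq_zero hf m.succ_ne_zero
    obtain ⟨s, u, hs, hu, hsu⟩ := ih (hf.divXSubC hr) (hm.divXSubC hf hr)
    refine ⟨r ::ₘ s, u, ?_, hu, fun x hx => ?_⟩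
    · simpa [hr] using hs
    · rw [hf.evalTsum_eq hr hx, hr0, zero_add, hsu x hx, Multiset.map_cons, Multiset.prod_cons,
        mul_assoc]

end Complete

end Ultrametric

/-! ### Quotients of restricted power series -/

lemma prod_map_sub_eq_prod_pow_count [DecidableEq K] {s : Multiset K} {t : Finset K}
    (h : s.toFinset ⊆ t) (y : K) :
    (s.map fun r => y - r).prod = ∏ r ∈ t, (y - r) ^ s.count r := by
  rw [Finset.prod_multiset_map_count]
  refine Finset.prod_subset h fun r _ hr => ?_
  rw [Multiset.count_eq_zero_of_notMem (by simpa using hr), pow_zero]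

/-- The rational function `∏ r, (y - r) ^ D r` with divisor `D`. -/
noncomputable def divisorProd (D : K →₀ ℤ) (y : K) : K := D.prod fun r n => (y - r) ^ n

lemma meromorphicAt_divisorProd (D : K →₀ ℤ) (x : K) : MeromorphicAt (divisorProd D) x := by
  unfold divisorProd Finsupp.prod
  fun_prop

lemma meromorphicOrderAt_divisorProd (D : K →₀ ℤ) (x : K) :
    meromorphicOrderAt (divisorProd D) x = D x := by
  unfold divisorProd Finsupp.prod
  rw [meromorphicOrderAt_fun_prod (fun r _ => by fun_prop)]
  have h : ∀ r, r ≠ x → meromorphicOrderAt (fun y => (y - r) ^ D r) x = 0 := by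
    intro r hr
    have ha : AnalyticAt K (fun y => (y - r) ^ D r) x :=
      AnalyticAt.fun_zpow (by fun_prop) (sub_ne_zero.2 hr.symm)
    refine (tendsto_ne_zero_iff_meromorphicOrderAt_eq_zero ha.meromorphicAt).1
      ⟨_, zpow_ne_zero _ (sub_ne_zero.2 hr.symm),
        ha.continuousAt.tendsto.mono_left nhdsWithin_le_nhds⟩
  rw [Finset.sum_eq_single x (fun r _ hr => h r hr)]
  · exact fun_meromorphicOrderAt_zpow_id_sub_const
  · intro hx
    simp only [Finsupp.notMem_support_iff.1 hx, zpow_zero]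
    exact (tendsto_ne_zero_iff_meromorphicOrderAt_eq_zero (by fun_prop)).1
      ⟨1, one_ne_zero, tendsto_const_nhds⟩

lemma analyticAt_divisorProd {D : K →₀ ℤ} {x : K} (hx : D x = 0) :
    AnalyticAt K (divisorProd D) x := by
  unfold divisorProd Finsupp.prod
  refine Finset.analyticAt_fun_prod _ fun r hr => AnalyticAt.fun_zpow (by fun_prop) ?_
  rintro h
  rw [sub_eq_zero] at h
  exact (Finsupp.mem_support_iff.1 hr) (h ▸ hx)

lemma divisorProd_ne_zero {D : K →₀ ℤ} {x : K} (hx : D x = 0) : divisorProd D x ≠ 0 := by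
  refine Finset.prod_ne_zero_iff.2 fun r hr => zpow_ne_zero _ ?_
  rintro h
  rw [sub_eq_zero] at h
  exact (Finsupp.mem_support_iff.1 hr) (h ▸ hx)

lemma logDeriv_divisorProd {D : K →₀ ℤ} {x : K} (hx : D x = 0) :
    logDeriv (divisorProd D) x = D.sum fun r n => n / (x - r) := by
  have hne : ∀ r ∈ D.support, x - r ≠ 0 := by
    rintro r hr h
    rw [sub_eq_zero] at h
    exact (Finsupp.mem_support_iff.1 hr) (h ▸ hx)
  have : divisorProd D = fun y => ∏ r ∈ D.support, (y - r) ^ D r := rfl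
  rw [this, logDeriv_prod (f := fun r y => (y - r) ^ D r) (fun r hr => zpow_ne_zero _ (hne r hr))
    (fun r hr => DifferentiableAt.zpow (by fun_prop) (Or.inl (hne r hr)))]
  refine Finset.sum_congr rfl fun r hr => ?_
  rw [logDeriv_fun_zpow (by fun_prop)]
  simp [logDeriv_apply, div_eq_mul_inv]

variable [IsUltrametricDist K] [CompleteSpace K]

/-- A quotient of restricted power series is, up to removable singularities, the product of a
rational function with divisor in the closed unit disc and a unit. -/
lemma exists_eventuallyEq_divisorProd_mul [IsAlgClosed K] {g h : K⟦X⟧} (hg : IsRestricted 1 g)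
    (hh : IsRestricted 1 h) (hg0 : g ≠ 0) (hh0 : h ≠ 0) {F : K → K}
    (hF : ∀ x, ‖x‖ ≤ 1 → evalTsum h x ≠ 0 → F x = evalTsum g x / evalTsum h x) :
    ∃ (D : K →₀ ℤ) (u : K⟦X⟧), (∀ r ∈ D.support, ‖r‖ ≤ 1) ∧ IsRestrictedUnit u ∧
      ∀ x, ‖x‖ ≤ 1 → F =ᶠ[𝓝[≠] x] fun y => divisorProd D y * evalTsum u y := by
  classical
  obtain ⟨s, u, hs, hu, hsu⟩ := hg.exists_eq_prod_mul_unit hg0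
  obtain ⟨t, v, ht, hv, htv⟩ := hh.exists_eq_prod_mul_unit hh0
  set T := s.toFinset ∪ t.toFinset with hT
  have hTle : ∀ r ∈ T, ‖r‖ ≤ 1 := fun r hr => by
    rcases Finset.mem_union.1 hr with hr | hr
    · exact hs r (by simpa using hr)
    · exact ht r (by simpa using hr)
  set D : K →₀ ℤ := Finsupp.onFinset T (fun r => (s.count r : ℤ) - t.count r) (by
    intro r hr
    by_contra hrT
    rw [hT, Finset.mem_union, not_or, Multiset.mem_toFinset, Multiset.mem_toFinset] at hrT
    simp [Multiset.count_eq_zero_of_notMem hrT.1, Multiset.count_eq_zero_of_notMem hrT.2] at hr)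
    with hD
  refine ⟨D, u * v⁻¹, fun r hr => hTle r (Finsupp.support_onFinset_subset hr), hu.mul hv.inv,
    fun x hx => ?_⟩
  have hfin : ∀ᶠ y in 𝓝[≠] x, y ∉ T := by
    have : ∀ᶠ y in 𝓝[≠] x, y ∈ ((T.erase x : Finset K) : Set K)ᶜ :=
      nhdsWithin_le_nhds ((T.erase x).finite_toSet.isClosed.isOpen_compl.mem_nhds (by simp))
    filter_upwards [this, self_mem_nhdsWithin] with y hy hyx hyT
    exact hy (Finset.mem_coe.2 (Finset.mem_erase.2 ⟨hyx, hyT⟩))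
  filter_upwards [hfin, nhdsWithin_le_nhds (eventually_norm_le_one hx)] with y hyT hy
  have hne : ∀ r ∈ T, y - r ≠ 0 := fun r hr h => hyT (sub_eq_zero.1 h ▸ hr)
  have hh' : evalTsum h y = (∏ r ∈ T, (y - r) ^ t.count r) * evalTsum v y := by
    rw [htv y hy, prod_map_sub_eq_prod_pow_count Finset.subset_union_right]
  have hg' : evalTsum g y = (∏ r ∈ T, (y - r) ^ s.count r) * evalTsum u y := by
    rw [hsu y hy, prod_map_sub_eq_prod_pow_count Finset.subset_union_left]
  have hhne : evalTsum h y ≠ 0 := by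
    rw [hh']
    exact mul_ne_zero (Finset.prod_ne_zero_iff.2 fun r hr => pow_ne_zero _ (hne r hr))
      (hv.evalTsum_ne_zero hy)
  have hDy : divisorProd D y = (∏ r ∈ T, (y - r) ^ s.count r) / ∏ r ∈ T, (y - r) ^ t.count r := by
    rw [← Finset.prod_div_distrib, divisorProd, hD, Finsupp.onFinset_prod _ (by simp)]
    refine Finset.prod_congr rfl fun r hr => ?_
    rw [zpow_sub₀ (hne r hr), zpow_natCast, zpow_natCast]
  rw [hF y hy hhne, hg', hh', hDy, evalTsum_mul hu.1 hv.2.2 hy,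
    eq_inv_of_mul_eq_one_right (hv.evalTsum_mul_inv hy)]
  simp only [div_eq_mul_inv, mul_inv]
  ring

lemma meromorphicOrderAt_of_eventuallyEq_divisorProd_mul {F : K → K} {D : K →₀ ℤ} {u : K⟦X⟧}
    (hu : IsRestrictedUnit u) {x : K} (hx : ‖x‖ ≤ 1)
    (hF : F =ᶠ[𝓝[≠] x] fun y => divisorProd D y * evalTsum u y) :
    meromorphicOrderAt F x = D x := by
  have ha := hu.1.analyticAt hx
  rw [meromorphicOrderAt_congr hF,
    fun_meromorphicOrderAt_mul (meromorphicAt_divisorProd D x) ha.meromorphicAt,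
    meromorphicOrderAt_divisorProd,
    (tendsto_ne_zero_iff_meromorphicOrderAt_eq_zero ha.meromorphicAt).1
      ⟨_, hu.evalTsum_ne_zero hx, ha.continuousAt.tendsto.mono_left nhdsWithin_le_nhds⟩, add_zero]

lemma logDeriv_of_eventuallyEq_divisorProd_mul {F : K → K} {D : K →₀ ℤ} {u : K⟦X⟧}
    (hu : IsRestrictedUnit u) {x : K} (hx : ‖x‖ ≤ 1) (hDx : D x = 0) (hFx : AnalyticAt K F x)
    (hF : F =ᶠ[𝓝[≠] x] fun y => divisorProd D y * evalTsum u y) :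
    logDeriv F x = (D.sum fun r n => n / (x - r)) +
      evalTsum (PowerSeries.derivative K u * u⁻¹) x := by
  have hu' := hu.1.analyticAt hx
  have hD' := analyticAt_divisorProd hDx
  have hev : F =ᶠ[𝓝 x] fun y => divisorProd D y * evalTsum u y :=
    (hFx.frequently_eq_iff_eventually_eq (hD'.mul hu')).1 hF.frequently
  rw [(logDeriv_congr_nhds hev).eq_of_nhds, logDeriv_mul x (divisorProd_ne_zero hDx)
    (hu.evalTsum_ne_zero hx) hD'.differentiableAt hu'.differentiableAt, logDeriv_divisorProd hDx,
    hu.logDeriv_evalTsum hx]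

end PowerSeries

/-! ### Sums over roots of unity -/

section RootsOfUnity

open Polynomial

variable {K : Type*} [Field K] [IsAlgClosed K] [CharZero K]

lemma exists_isPrimitiveRoot_of_isAlgClosed {N : ℕ} (hN : N ≠ 0) :
    ∃ ξ : K, IsPrimitiveRoot ξ N :=
  have : NeZero N := ⟨hN⟩
  HasEnoughRootsOfUnity.exists_primitiveRoot K N

/-- Logarithmic differentiation of `X ^ N - 1 = ∏ ζ, (X - ζ)` at `r`. -/
lemma sum_nthRootsFinset_div_sub {N : ℕ} (hN : N ≠ 0) {r : K} (hr : r ^ N ≠ 1) :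
    ∑ ζ ∈ nthRootsFinset N (1 : K), ζ / (ζ - r) = N / (1 - r ^ N) := by
  classical
  obtain ⟨ξ, hξ⟩ := exists_isPrimitiveRoot_of_isAlgClosed (K := K) hN
  have hr' : r ^ N - 1 ≠ 0 := sub_ne_zero.2 hr
  have h := Splits.eval_derivative_div_eval_of_ne_zero
    (IsAlgClosed.splits (Polynomial.X ^ N - Polynomial.C (1 : K))) (x := r) (by simpa using hr')
  have hroots :
      (Polynomial.X ^ N - Polynomial.C (1 : K)).roots = (nthRootsFinset N (1 : K)).val := by
    rw [nthRootsFinset, ← Multiset.toFinset_eq hξ.nthRoots_one_nodup]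
    rfl
  rw [hroots] at h
  have h' : (N : K) * r ^ (N - 1) / (r ^ N - 1) =
      ∑ ζ ∈ nthRootsFinset N (1 : K), 1 / (r - ζ) := by
    rw [Finset.sum, ← h]
    simp [Polynomial.derivative_X_pow]
  have hterm : ∀ ζ ∈ nthRootsFinset N (1 : K), ζ / (ζ - r) = 1 - r * (1 / (r - ζ)) := by
    intro ζ hζ
    have hζN := (mem_nthRootsFinset (Nat.pos_of_ne_zero hN) 1).1 hζ
    have hne : r - ζ ≠ 0 := fun h => hr (by rw [sub_eq_zero.1 h, hζN])
    have hne' : ζ - r ≠ 0 := fun h => hne (by rw [← neg_sub, h, neg_zero])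
    field_simp
    ring
  rw [Finset.sum_congr rfl hterm, Finset.sum_sub_distrib, ← Finset.mul_sum, ← h', Finset.sum_const,
    hξ.card_nthRootsFinset]
  have hpow : r * r ^ (N - 1) = r ^ N := by
    rw [← pow_succ', Nat.sub_add_cancel (Nat.pos_of_ne_zero hN)]
  have h1 : r * (N * r ^ (N - 1) / (r ^ N - 1)) = N * r ^ N / (r ^ N - 1) := by
    rw [← hpow]
    ring
  have hr'' : 1 - r ^ N ≠ 0 := fun h => hr' (by rw [← neg_sub, h, neg_zero])
  rw [h1]
  simp only [nsmul_eq_mul, mul_one]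
  field_simp
  ring

lemma sum_nthRootsFinset_pow_eq_zero {N : ℕ} (hN : N ≠ 0) {j : ℕ} (hj : ¬ N ∣ j) :
    ∑ ζ ∈ nthRootsFinset N (1 : K), ζ ^ j = 0 := by
  obtain ⟨ξ, hξ⟩ := exists_isPrimitiveRoot_of_isAlgClosed (K := K) hN
  have hξ0 : ξ ≠ 0 := hξ.ne_zero hN
  have hmem : ∀ ζ : K, ζ ∈ nthRootsFinset N (1 : K) ↔ ζ ^ N = 1 := fun ζ =>
    mem_nthRootsFinset (Nat.pos_of_ne_zero hN) 1
  have hshift : ∑ ζ ∈ nthRootsFinset N (1 : K), ζ ^ j =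
      ∑ ζ ∈ nthRootsFinset N (1 : K), (ξ * ζ) ^ j := by
    refine (Finset.sum_nbij' (ξ * ·) (ξ⁻¹ * ·) ?_ ?_ ?_ ?_ ?_).symm
    · intro ζ hζ
      rw [hmem] at hζ ⊢
      rw [mul_pow, hζ, hξ.pow_eq_one, mul_one]
    · intro ζ hζ
      rw [hmem] at hζ ⊢
      rw [mul_pow, hζ, inv_pow, hξ.pow_eq_one, inv_one, mul_one]
    · intro ζ _
      exact inv_mul_cancel_left₀ hξ0 ζ
    · intro ζ _
      exact mul_inv_cancel_left₀ hξ0 ζ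
    · intro ζ _
      rfl
  simp only [mul_pow, ← Finset.mul_sum] at hshift
  have h1 : ξ ^ j ≠ 1 := fun h => hj ((hξ.pow_eq_one_iff_dvd j).1 h)
  by_contra h0
  exact h1 (mul_right_cancel₀ h0 (by rw [one_mul]; exact hshift.symm))

lemma sum_nthRootsFinset_pow_of_dvd {N : ℕ} (hN : N ≠ 0) {j : ℕ} (hj : N ∣ j) :
    ∑ ζ ∈ nthRootsFinset N (1 : K), ζ ^ j = N := by
  obtain ⟨ξ, hξ⟩ := exists_isPrimitiveRoot_of_isAlgClosed (K := K) hN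
  obtain ⟨k, rfl⟩ := hj
  rw [Finset.sum_congr rfl (g := fun _ => (1 : K)), Finset.sum_const, hξ.card_nthRootsFinset]
  · simp
  · intro ζ hζ
    rw [pow_mul, (mem_nthRootsFinset (Nat.pos_of_ne_zero hN) 1).1 hζ, one_pow]

end RootsOfUnity

section Mean

variable {K : Type*} [NontriviallyNormedField K] [IsUltrametricDist K] [CompleteSpace K]
  [IsAlgClosed K] [CharZero K]

/-- Averaging `ζ * f ζ` over the `N`-th roots of unity leaves only the coefficients of `f` with
index congruent to `-1` modulo `N`. -/
lemma norm_mean_mul_evalTsum_le {f : K⟦X⟧} (hf : IsRestricted 1 f) {N : ℕ} (hN : N ≠ 0) {B : ℝ}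
    (hB0 : 0 ≤ B) (hB : ∀ n, N ≤ n + 1 → ‖coeff n f‖ ≤ B) :
    ‖(N : K)⁻¹ * ∑ ζ ∈ Polynomial.nthRootsFinset N (1 : K), ζ * evalTsum f ζ‖ ≤ B := by
  have hnorm : ∀ ζ ∈ Polynomial.nthRootsFinset N (1 : K), ‖ζ‖ ≤ 1 := fun ζ hζ =>
    (isOfFinOrder_iff_pow_eq_one.2 ⟨N, Nat.pos_of_ne_zero hN,
      (Polynomial.mem_nthRootsFinset (Nat.pos_of_ne_zero hN) 1).1 hζ⟩).norm_eq_one.le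
  have hsum : HasSum (fun n => (N : K)⁻¹ * ∑ ζ ∈ Polynomial.nthRootsFinset N (1 : K),
      ζ * (coeff n f * ζ ^ n))
      ((N : K)⁻¹ * ∑ ζ ∈ Polynomial.nthRootsFinset N (1 : K), ζ * evalTsum f ζ) :=
    (hasSum_sum fun ζ hζ => (hf.hasSum (hnorm ζ hζ)).mul_left ζ).mul_left _
  rw [← hsum.tsum_eq]
  refine IsUltrametricDist.norm_tsum_le_of_forall_le (fun n => ?_)
  have : ∑ ζ ∈ Polynomial.nthRootsFinset N (1 : K), ζ * (coeff n f * ζ ^ n) =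
      coeff n f * ∑ ζ ∈ Polynomial.nthRootsFinset N (1 : K), ζ ^ (n + 1) := by
    rw [Finset.mul_sum]
    exact Finset.sum_congr rfl fun ζ _ => by ring
  rw [this]
  by_cases hd : N ∣ n + 1
  · rw [sum_nthRootsFinset_pow_of_dvd hN hd, mul_left_comm,
      inv_mul_cancel₀ (Nat.cast_ne_zero.2 hN), mul_one]
    exact hB n (Nat.le_of_dvd n.succ_pos hd)
  · simpa [sum_nthRootsFinset_pow_eq_zero hN hd] using hB0

end Mean

/-! ### Raising to the `p`-th power near a point of the unit disc -/

section PthPower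

variable {K : Type*} [NormedField K] [IsUltrametricDist K] {p : ℕ}

/-- The difference of two `p`-th powers is the `p`-th power of the difference modulo `p`. -/
lemma exists_pow_prime_sub_pow_eq (hp : p.Prime) {x y : K} (hx : ‖x‖ ≤ 1) (hy : ‖y‖ ≤ 1) :
    ∃ r : K, ‖r‖ ≤ 1 ∧ x ^ p - y ^ p = (x - y) ^ p + p * (x - y) * r := by
  have hd : ‖x - y‖ ≤ 1 := norm_sub_le_one hx hy
  have h := add_pow_prime_eq hp (x - y) y
  rw [sub_add_cancel] at h
  refine ⟨_, ?_, by rw [h, add_sub_right_comm, add_sub_cancel_right, mul_assoc]⟩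
  rw [norm_mul]
  refine mul_le_one₀ hy (norm_nonneg _) ?_
  refine IsUltrametricDist.norm_sum_le_of_forall_le_of_nonneg zero_le_one fun k _ => ?_
  rw [norm_mul, norm_mul, norm_pow, norm_pow]
  exact mul_le_one₀ (mul_le_one₀ (pow_le_one₀ (norm_nonneg _) hd) (by positivity)
    (pow_le_one₀ (norm_nonneg _) hy)) (norm_nonneg _) (IsUltrametricDist.norm_natCast_le_one K _)

lemma norm_pow_prime_sub_pow_le (hp : p.Prime) {x y : K} (hx : ‖x‖ ≤ 1) (hy : ‖y‖ ≤ 1) :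
    ‖x ^ p - y ^ p‖ ≤ max ‖x - y‖ ‖(p : K)‖ * ‖x - y‖ := by
  obtain ⟨r, hr, h⟩ := exists_pow_prime_sub_pow_eq hp hx hy
  have hd : ‖x - y‖ ≤ 1 := norm_sub_le_one hx hy
  rw [h, max_mul_of_nonneg _ _ (norm_nonneg _)]
  refine (IsUltrametricDist.norm_add_le_max _ _).trans (max_le_max ?_ ?_)
  · rw [norm_pow, ← pow_two]
    exact pow_le_pow_of_le_one (norm_nonneg _) hd hp.two_le
  · rw [norm_mul, norm_mul]
    exact mul_le_of_le_one_right (by positivity) hr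

lemma norm_pow_prime_pow_sub_pow_le (hp : p.Prime) {x y : K} (hx : ‖x‖ ≤ 1) (hy : ‖y‖ ≤ 1)
    {ρ : ℝ} (hρ : max ‖x - y‖ ‖(p : K)‖ ≤ ρ) (hρ1 : ρ ≤ 1) (n : ℕ) :
    ‖x ^ p ^ n - y ^ p ^ n‖ ≤ ρ ^ (n + 1) := by
  have hρ0 : 0 ≤ ρ := (norm_nonneg _).trans ((le_max_left _ _).trans hρ)
  induction n with
  | zero => simpa using (le_max_left _ _).trans hρ
  | succ n ih =>
    rw [pow_succ p n, pow_mul, pow_mul]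
    refine (norm_pow_prime_sub_pow_le hp (by rw [norm_pow]; exact pow_le_one₀ (norm_nonneg _) hx)
      (by rw [norm_pow]; exact pow_le_one₀ (norm_nonneg _) hy)).trans ?_
    have h1 : ‖x ^ p ^ n - y ^ p ^ n‖ ≤ ρ := ih.trans (pow_le_of_le_one hρ0 hρ1 n.succ_ne_zero)
    rw [pow_succ' ρ (n + 1)]
    exact mul_le_mul (max_le h1 ((le_max_right _ _).trans hρ)) ih (norm_nonneg _) hρ0

/-- Points at distance less than `1` in the closed unit disc have asymptotically equal
`p ^ n`-th powers. -/
lemma tendsto_pow_prime_pow_sub_pow (hp : p.Prime) (hpK : ‖(p : K)‖ < 1) {x y : K} (hx : ‖x‖ ≤ 1)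
    (hy : ‖y‖ ≤ 1) (hxy : ‖x - y‖ < 1) :
    Tendsto (fun n => x ^ p ^ n - y ^ p ^ n) atTop (𝓝 0) := by
  have hlt : max ‖x - y‖ ‖(p : K)‖ < 1 := max_lt hxy hpK
  refine squeeze_zero_norm (norm_pow_prime_pow_sub_pow_le hp hx hy le_rfl hlt.le) ?_
  exact (tendsto_add_atTop_iff_nat 1).2
    (tendsto_pow_atTop_nhds_zero_of_lt_one ((norm_nonneg _).trans (le_max_left _ _)) hlt)

lemma norm_sub_one_lt_of_norm_pow_prime_sub_one_lt (hp : p.Prime) (hpK : ‖(p : K)‖ < 1) {x : K}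
    (hx : ‖x‖ ≤ 1) (h : ‖x ^ p - 1‖ < 1) : ‖x - 1‖ < 1 := by
  obtain ⟨r, hr, he⟩ := exists_pow_prime_sub_pow_eq hp hx (norm_one (α := K)).le
  have hd : ‖x - 1‖ ≤ 1 := norm_sub_le_one hx norm_one.le
  have h1 : ‖-(p * (x - 1) * r)‖ < 1 := by
    rw [norm_neg, norm_mul, norm_mul]
    exact (mul_le_of_le_one_right (by positivity) hr).trans_lt
      ((mul_le_of_le_one_right (norm_nonneg _) hd).trans_lt hpK)
  have h2 : (x - 1) ^ p = (x ^ p - 1) + -(p * (x - 1) * r) := by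
    rw [one_pow] at he
    rw [he]
    ring
  have h3 : ‖x - 1‖ ^ p < 1 := by
    rw [← norm_pow, h2]
    exact (IsUltrametricDist.norm_add_le_max _ _).trans_lt (max_lt h h1)
  by_contra! hge
  exact (one_le_pow₀ hge).not_gt h3

lemma norm_sub_one_lt_of_norm_pow_prime_pow_sub_one_lt (hp : p.Prime) (hpK : ‖(p : K)‖ < 1) {x : K}
    (hx : ‖x‖ ≤ 1) {n : ℕ} (h : ‖x ^ p ^ n - 1‖ < 1) : ‖x - 1‖ < 1 := by
  induction n with
  | zero => simpa using h
  | succ n ih =>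
    refine ih (norm_sub_one_lt_of_norm_pow_prime_sub_one_lt hp hpK ?_ ?_)
    · rw [norm_pow]
      exact pow_le_one₀ (norm_nonneg _) hx
    · rwa [← pow_mul, ← pow_succ]

end PthPower

/-! ### Existence of Teichmüller representatives -/

/-- An algebraic element of norm `1` has a power close to `1`: its powers lie in a compact subset
of a finite-dimensional space, so two of them are close to each other. -/
lemma exists_norm_pow_sub_one_lt_of_isIntegral {k L : Type*} [NontriviallyNormedField k]
    [LocallyCompactSpace k] [NormedField L] [NormedAlgebra k L] {y : L} (hint : IsIntegral k y)
    (hy : ‖y‖ = 1) : ∃ n, 0 < n ∧ ‖y ^ n - 1‖ < 1 := by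
  let V : Submodule k L := Subalgebra.toSubmodule (Algebra.adjoin k {y})
  have : FiniteDimensional k V := Module.Finite.iff_fg.2 hint.fg_adjoin_singleton
  have : ProperSpace V := FiniteDimensional.proper k V
  let w : ℕ → V := fun n => ⟨y ^ n, Subalgebra.pow_mem _ (Algebra.self_mem_adjoin_singleton k y) n⟩
  obtain ⟨v, -, φ, hφ, hlim⟩ := (isCompact_closedBall (0 : V) 1).tendsto_subseq (x := w)
    (fun n => by
      rw [mem_closedBall_zero_iff]
      change ‖y ^ n‖ ≤ 1
      rw [norm_pow, hy, one_pow])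
  obtain ⟨N, hN⟩ := Metric.cauchySeq_iff.1 hlim.cauchySeq 1 one_pos
  have hlt := hN (N + 1) (Nat.le_succ N) N le_rfl
  have hφlt : φ N < φ (N + 1) := hφ (Nat.lt_succ_self N)
  refine ⟨φ (N + 1) - φ N, by omega, ?_⟩
  rw [dist_eq_norm] at hlt
  change ‖y ^ φ (N + 1) - y ^ φ N‖ < 1 at hlt
  rwa [← Nat.add_sub_of_le hφlt.le, pow_add, ← mul_sub_one, norm_mul, norm_pow, hy, one_pow,
    one_mul] at hlt

namespace PadicComplex

variable {p : ℕ} [Fact p.Prime]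

lemma norm_prime_lt_one : ‖(p : ℂ_[p])‖ < 1 := by
  have h2 : algebraMap ℚ_[p] ℂ_[p] (p : ℚ_[p]) = (p : ℂ_[p]) := map_natCast _ p
  have h3 : ‖algebraMap ℚ_[p] ℂ_[p] (p : ℚ_[p])‖ = (p : ℝ)⁻¹ := by
    rw [norm_algebraMap', Padic.norm_p]
  rw [← h2, h3]
  exact inv_lt_one_of_one_lt₀ (by exact_mod_cast (Fact.out : p.Prime).one_lt)

/-- Every unit of `ℂ_[p]` is close to a root of unity of order prime to `p`. -/
lemma exists_rootOfUnity_norm_sub_lt {x : ℂ_[p]} (hx : ‖x‖ = 1) :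
    ∃ ζ : ℂ_[p], (∃ n : ℕ, 0 < n ∧ n.Coprime p ∧ ζ ^ n = 1) ∧ ‖x - ζ‖ < 1 := by
  have hp : p.Prime := Fact.out
  obtain ⟨y, hxy⟩ := UniformSpace.Completion.denseRange_coe.exists_dist_lt x (one_pos)
  rw [dist_eq_norm] at hxy
  have hy' : ‖(y : ℂ_[p])‖ = 1 := by
    have h1 : (y : ℂ_[p]) = x + -(x - y) := by ring
    rw [h1, IsUltrametricDist.norm_add_eq_max_of_norm_ne_norm, hx, norm_neg, max_eq_left hxy.le]
    rw [hx, norm_neg]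
    exact hxy.ne'
  have hy : ‖y‖ = 1 := by rwa [norm_extends] at hy'
  obtain ⟨n, hn, hyn⟩ := exists_norm_pow_sub_one_lt_of_isIntegral
    (Algebra.IsIntegral.isIntegral (R := ℚ_[p]) y) hy
  obtain ⟨e, m, hm, hnm⟩ := Nat.exists_eq_pow_mul_and_not_dvd hn.ne' p hp.ne_one
  have hm0 : 0 < m := Nat.pos_of_ne_zero fun h => hm (h ▸ dvd_zero p)
  have hyn' : ‖((y : ℂ_[p]) ^ m) ^ p ^ e - 1‖ < 1 := by
    rw [← pow_mul, mul_comm, ← hnm]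
    have : (y : ℂ_[p]) ^ n - 1 = ((y ^ n - 1 : PadicAlgCl p) : ℂ_[p]) := by
      simp only [coe_eq, map_sub, map_pow, map_one]
    rw [this, norm_extends]
    exact hyn
  have hym := norm_sub_one_lt_of_norm_pow_prime_pow_sub_one_lt hp norm_prime_lt_one
    (by rw [norm_pow, hy', one_pow]) hyn'
  -- `y ^ m - 1` is the product of the `y - ζ` over the `m`-th roots of unity
  obtain ⟨ξ, hξ⟩ := exists_isPrimitiveRoot_of_isAlgClosed (K := ℂ_[p]) hm0.ne'
  have hprod := congrArg (Polynomial.eval (y : ℂ_[p])) (Polynomial.X_pow_sub_one_eq_prod hm0 hξ)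
  simp only [Polynomial.eval_sub, Polynomial.eval_pow, Polynomial.eval_X, Polynomial.eval_one,
    Polynomial.eval_prod, Polynomial.eval_C] at hprod
  rw [hprod, norm_prod] at hym
  obtain ⟨ζ, hζ, hyζ⟩ : ∃ ζ ∈ Polynomial.nthRootsFinset m (1 : ℂ_[p]), ‖(y : ℂ_[p]) - ζ‖ < 1 := by
    by_contra! h
    exact hym.not_ge (by simpa using Finset.prod_le_prod (fun _ _ => zero_le_one) h)
  refine ⟨ζ, ⟨m, hm0, ?_, (Polynomial.mem_nthRootsFinset hm0 1).1 hζ⟩, ?_⟩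
  · exact (Nat.coprime_comm.1 ((Nat.Prime.coprime_iff_not_dvd hp).2 hm))
  · exact norm_sub_lt_one_trans hxy hyζ

end PadicComplex

namespace PadicArc

variable {p : ℕ} [Fact p.Prime]

lemma norm_sub_teichmuller_lt {x : ℂ_[p]} (hx : ‖x‖ ≤ 1) : ‖x - teichmuller x‖ < 1 := by
  unfold teichmuller
  split_ifs with h1 h2
  · simpa using h1
  · exact h2.choose_spec.2
  · exact absurd (PadicComplex.exists_rootOfUnity_norm_sub_lt (hx.antisymm (not_lt.1 h1))) h2

/-- A Teichmüller representative is fixed by a power of the `p`-th power map. -/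
lemma exists_teichmuller_pow_eq (x : ℂ_[p]) :
    ∃ l, 0 < l ∧ teichmuller x ^ p ^ l = teichmuller x := by
  have hp : p.Prime := Fact.out
  unfold teichmuller
  split_ifs with h1 h2
  · exact ⟨1, one_pos, zero_pow (pow_ne_zero _ hp.ne_zero)⟩
  · obtain ⟨n, hn, hnp, hζ⟩ := h2.choose_spec.1
    refine ⟨n.totient, Nat.totient_pos.2 hn, ?_⟩
    have h : p ^ n.totient ≡ 1 [MOD n] := Nat.ModEq.pow_totient hnp.symm
    have h1 : 1 ≤ p ^ n.totient := Nat.one_le_pow _ _ hp.pos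
    obtain ⟨q, hq⟩ := (Nat.modEq_iff_dvd' h1).1 h.symm
    rw [← Nat.sub_add_cancel h1, hq, pow_succ, pow_mul, hζ, one_pow, one_mul]
  · exact ⟨1, one_pos, zero_pow (pow_ne_zero _ hp.ne_zero)⟩

/-! ### The divisor of a meromorphic function on a closed disc -/

lemma affine_mem_closedBall {a b : ℂ_[p]} {R : ℝ} (hb : ‖b - a‖ = R) {t : ℂ_[p]} (ht : ‖t‖ ≤ 1) :
    a + (b - a) * t ∈ Metric.closedBall a R := by
  rw [mem_closedBall_iff_norm, add_sub_cancel_left, norm_mul, hb]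
  exact mul_le_of_le_one_right (hb ▸ norm_nonneg _) ht

/-- In the coordinate `t` with `x = a + (b - a) t`, a holomorphic function on the closed disc
through `b` is a restricted power series: convergence at `b` means that the coefficients tend to
zero. -/
lemma HolomorphicOnDisc.exists_isRestricted {g : ℂ_[p] → ℂ_[p]} {a b : ℂ_[p]} {R : ℝ}
    (hg : HolomorphicOnDisc g a R) (hb : ‖b - a‖ = R) :
    ∃ G : ℂ_[p]⟦X⟧, IsRestricted 1 G ∧
      ∀ t, ‖t‖ ≤ 1 → evalTsum G t = g (a + (b - a) * t) := by
  obtain ⟨c, hc⟩ := hg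
  refine ⟨PowerSeries.mk fun n => c n * (b - a) ^ n, ?_, fun t ht => ?_⟩
  · rw [isRestricted_one_iff]
    simp only [coeff_mk]
    exact (hc b (by rw [mem_closedBall_iff_norm, hb])).summable.tendsto_atTop_zero
  · rw [← (hc _ (affine_mem_closedBall hb ht)).tsum_eq, evalTsum]
    refine tsum_congr fun n => ?_
    rw [coeff_mk, add_sub_cancel_left, mul_pow, mul_assoc]

lemma meromorphicOrderAt_comp_affine (f : ℂ_[p] → ℂ_[p]) {a β : ℂ_[p]} (hβ : β ≠ 0) (t : ℂ_[p]) :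
    meromorphicOrderAt (fun t => f (a + β * t)) t = meromorphicOrderAt f (a + β * t) := by
  have hd : HasDerivAt (fun t => a + β * t) β t := by
    simpa using ((hasDerivAt_id t).const_mul β).const_add a
  exact meromorphicOrderAt_comp_of_deriv_ne_zero (f := f) (g := fun t => a + β * t) (by fun_prop)
    (by rw [hd.deriv]; exact hβ)

/-- In the coordinate `t` with `x = a + (b - a) t`, a meromorphic function `f` on the disc has a
finite divisor `D`, and its logarithmic derivative is that of the rational function with divisor
`D` up to a restricted power series. -/
lemma MeromorphicOnDisc.exists_divisor {f : ℂ_[p] → ℂ_[p]} {a b : ℂ_[p]} {R : ℝ}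
    (hf : MeromorphicOnDisc f a R) (hR : 0 < R) (hb : ‖b - a‖ = R)
    (hord : meromorphicOrderAt f b ≠ ⊤) :
    ∃ (D : ℂ_[p] →₀ ℤ) (L : ℂ_[p]⟦X⟧), (∀ r ∈ D.support, ‖r‖ ≤ 1) ∧ IsRestricted 1 L ∧
      (∀ t, ‖t‖ ≤ 1 → meromorphicOrderAt f (a + (b - a) * t) = D t) ∧
      ∀ t, ‖t‖ ≤ 1 → D t = 0 →
        (b - a) * (deriv f (a + (b - a) * t) / f (a + (b - a) * t)) =
          (D.sum fun r n => n / (t - r)) + evalTsum L t := by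
  have hβ : b - a ≠ 0 := norm_pos_iff.1 (hb ▸ hR)
  obtain ⟨g, h, hg, hh, ⟨x₀, hx₀, hhx₀⟩, hfgh, hana⟩ := hf
  obtain ⟨G, hG, hGg⟩ := hg.exists_isRestricted hb
  obtain ⟨H, hH, hHh⟩ := hh.exists_isRestricted hb
  set F : ℂ_[p] → ℂ_[p] := fun t => f (a + (b - a) * t) with hF
  have hFq : ∀ t, ‖t‖ ≤ 1 → evalTsum H t ≠ 0 → F t = evalTsum G t / evalTsum H t := by
    intro t ht hne
    rw [hGg t ht, hHh t ht]
    exact hfgh _ (affine_mem_closedBall hb ht) (hHh t ht ▸ hne)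
  have hH0 : H ≠ 0 := by
    rintro rfl
    have ht : ‖(x₀ - a) / (b - a)‖ ≤ 1 := by
      rw [norm_div, hb, div_le_one hR]
      exact mem_closedBall_iff_norm.1 hx₀
    have h0 := hHh _ ht
    rw [mul_div_cancel₀ _ hβ, add_sub_cancel] at h0
    exact hhx₀ (by rw [← h0]; simp [evalTsum])
  have h1 : ‖(1 : ℂ_[p])‖ ≤ 1 := norm_one.le
  -- if `G = 0`, then `f` would vanish identically near `b`, which corresponds to `t = 1`
  have hG0 : G ≠ 0 := by
    rintro rfl
    refine hord ?_
    have hb1 : b = a + (b - a) * 1 := by ring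
    rw [hb1, ← meromorphicOrderAt_comp_affine f hβ, meromorphicOrderAt_eq_top_iff]
    obtain ⟨D, u, -, hu, hDu⟩ := exists_eventuallyEq_divisorProd_mul (isRestricted_one 1) hH
      one_ne_zero hH0 (F := fun t => evalTsum 1 t / evalTsum H t) (fun _ _ _ => rfl)
    have hne : ∀ᶠ t in 𝓝[≠] (1 : ℂ_[p]), evalTsum H t ≠ 0 := by
      refine ((hH.analyticAt h1).eventually_eq_zero_or_eventually_ne_zero).resolve_left fun h0 => ?_
      have htop : meromorphicOrderAt (fun t => evalTsum 1 t / evalTsum H t) (1 : ℂ_[p]) = ⊤ := by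
        rw [meromorphicOrderAt_eq_top_iff]
        filter_upwards [nhdsWithin_le_nhds h0] with t ht
        rw [ht, div_zero]
      rw [meromorphicOrderAt_of_eventuallyEq_divisorProd_mul hu h1 (hDu 1 h1)] at htop
      exact WithTop.coe_ne_top htop
    filter_upwards [hne, nhdsWithin_le_nhds (eventually_norm_le_one h1)] with t ht ht1
    change F t = 0
    rw [hFq t ht1 ht]
    simp [evalTsum]
  obtain ⟨D, u, hDs, hu, hDu⟩ := exists_eventuallyEq_divisorProd_mul hG hH hG0 hH0 hFq
  have hordD : ∀ t, ‖t‖ ≤ 1 → meromorphicOrderAt f (a + (b - a) * t) = D t := fun t ht => by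
    rw [← meromorphicOrderAt_comp_affine f hβ]
    exact meromorphicOrderAt_of_eventuallyEq_divisorProd_mul hu ht (hDu t ht)
  refine ⟨D, PowerSeries.derivative ℂ_[p] u * u⁻¹, hDs, isRestricted.mul 1 hu.1.derivative hu.2.2,
    hordD, fun t ht hDt => ?_⟩
  have hfa : AnalyticAt ℂ_[p] f (a + (b - a) * t) :=
    hana _ (affine_mem_closedBall hb ht) (by rw [hordD t ht, hDt]; rfl)
  have haff : AnalyticAt ℂ_[p] (fun t => a + (b - a) * t) t := by fun_prop
  have hFa : AnalyticAt ℂ_[p] F t := hfa.comp (f := fun t => a + (b - a) * t) haff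
  rw [← logDeriv_of_eventuallyEq_divisorProd_mul hu ht hDt hFa (hDu t ht), logDeriv_apply]
  have hd : HasDerivAt (fun t => a + (b - a) * t) (b - a) t := by
    simpa using ((hasDerivAt_id t).const_mul (b - a)).const_add a
  have hFd : deriv F t = deriv f (a + (b - a) * t) * (b - a) :=
    (hfa.differentiableAt.hasDerivAt.comp t hd).deriv
  rw [hFd]
  simp only [hF]
  ring

/-- The number of zeros minus the number of poles is the degree of the divisor. -/
lemma zeroCount_sub_poleCount {f : ℂ_[p] → ℂ_[p]} {a b : ℂ_[p]} {R : ℝ} (hR : 0 < R)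
    (hb : ‖b - a‖ = R) {D : ℂ_[p] →₀ ℤ} (hDs : ∀ r ∈ D.support, ‖r‖ ≤ 1)
    (hD : ∀ t, ‖t‖ ≤ 1 → meromorphicOrderAt f (a + (b - a) * t) = D t) {s : Set ℂ_[p]}
    (hs : s ⊆ Metric.closedBall a R) [DecidablePred fun r => a + (b - a) * r ∈ s] :
    (zeroCount f s : ℂ_[p]) - poleCount f s =
      ∑ r ∈ D.support with a + (b - a) * r ∈ s, (D r : ℂ_[p]) := by
  classical
  have hβ : b - a ≠ 0 := norm_pos_iff.1 (hb ▸ hR)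
  have hinj : Function.Injective fun r => a + (b - a) * r := fun r r' h =>
    mul_left_cancel₀ hβ (add_left_cancel h)
  have key : ∀ q : ℤ → ℕ, q 0 = 0 →
      ∑ᶠ x ∈ s, q (meromorphicOrderAt f x).untop₀ =
        ∑ r ∈ D.support with a + (b - a) * r ∈ s, q (D r) := by
    intro q hq
    rw [finsum_mem_eq_sum_of_subset
      (t := (D.support.filter fun r => a + (b - a) * r ∈ s).image fun r => a + (b - a) * r),
      Finset.sum_image hinj.injOn]
    · refine Finset.sum_congr rfl fun r hr => ?_
      rw [hD r (hDs r (Finset.mem_filter.1 hr).1), WithTop.untop₀_coe]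
    · rintro x ⟨hxs, hx⟩
      have hxt : a + (b - a) * ((x - a) / (b - a)) = x := by
        rw [mul_div_cancel₀ _ hβ, add_sub_cancel]
      have ht : ‖(x - a) / (b - a)‖ ≤ 1 := by
        rw [norm_div, hb, div_le_one hR]
        exact mem_closedBall_iff_norm.1 (hs hxs)
      have hord := hD _ ht
      rw [hxt] at hord
      rw [Finset.coe_image]
      refine ⟨(x - a) / (b - a), ?_, hxt⟩
      rw [Finset.coe_filter, Set.mem_ofPred_eq, Finsupp.mem_support_iff, hxt]
      refine ⟨fun h0 => hx ?_, hxs⟩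
      simpa [hord, h0] using hq
    · intro x hx
      obtain ⟨r, hr, rfl⟩ := Finset.mem_image.1 (Finset.mem_coe.1 hx)
      exact (Finset.mem_filter.1 hr).2
  rw [zeroCount, poleCount, key Int.toNat rfl, key (fun n => (-n).toNat) rfl, Nat.cast_sum,
    Nat.cast_sum, ← Finset.sum_sub_distrib]
  refine Finset.sum_congr rfl fun r _ => ?_
  have h := Int.toNat_sub_toNat_neg (D r)
  conv_rhs => rw [← h]
  push_cast
  rfl

/-! ### The arc integral of the logarithmic derivative -/

/-- If `ω` is fixed by the `p ^ l`-th power map, the powers of any `r` in its residue disc along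
`k ↦ p ^ (α + l * k)` converge to `ω ^ p ^ α`. -/
lemma tendsto_pow_of_teichmuller {α l : ℕ} {r ω : ℂ_[p]} (hr : ‖r‖ ≤ 1) (hω : ‖ω‖ ≤ 1)
    (hrω : ‖r - ω‖ < 1) (hl : 0 < l) (hωl : ω ^ p ^ l = ω) :
    Tendsto (fun k => r ^ p ^ (α + l * k)) atTop (𝓝 (ω ^ p ^ α)) := by
  have hp : p.Prime := Fact.out
  have h := tendsto_pow_prime_pow_sub_pow hp PadicComplex.norm_prime_lt_one hr hω hrω
  have hsub : Tendsto (fun k => α + l * k) atTop atTop :=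
    tendsto_atTop_mono (fun k => (Nat.le_mul_of_pos_left k hl).trans (Nat.le_add_left _ _))
      tendsto_id
  have hfix : ∀ k, ω ^ p ^ (α + l * k) = ω ^ p ^ α := by
    intro k
    induction k with
    | zero => simp
    | succ k ih =>
      rw [Nat.mul_succ, ← add_assoc, add_comm, pow_add p, pow_mul, hωl, ih]
  have h2 := (h.comp hsub).add_const (ω ^ p ^ α)
  rw [zero_add] at h2
  refine h2.congr fun k => ?_
  simp [hfix]

/-- A restricted power series does not contribute to the arc integral. -/
lemma tendsto_mean_mul_evalTsum {L : ℂ_[p]⟦X⟧} (hL : IsRestricted 1 L) {α l : ℕ} (hl : 0 < l) :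
    Tendsto (fun k => ((p ^ (α + l * k) : ℕ) : ℂ_[p])⁻¹ *
      ∑ ζ ∈ Polynomial.nthRootsFinset (p ^ (α + l * k)) (1 : ℂ_[p]), ζ * evalTsum L ζ)
      atTop (𝓝 0) := by
  have hp : p.Prime := Fact.out
  rw [NormedAddGroup.tendsto_nhds_zero]
  intro ε hε
  have hL' := (isRestricted_one_iff.1 hL).norm
  rw [norm_zero] at hL'
  obtain ⟨N, hN⟩ := eventually_atTop.1 (hL'.eventually_lt_const (half_pos hε))
  filter_upwards [eventually_ge_atTop (N + 1)] with k hk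
  refine (norm_mean_mul_evalTsum_le hL (pow_ne_zero _ hp.ne_zero) (half_pos hε).le
    fun n hn => (hN n ?_).le).trans_lt (half_lt_self hε)
  have h1 : α + l * k < p ^ (α + l * k) := Nat.lt_pow_self hp.one_lt
  have h2 : k ≤ l * k := Nat.le_mul_of_pos_left k hl
  omega

lemma hasArcIntegral_of_tendsto {a b L : ℂ_[p]} {f : ℂ_[p] → ℂ_[p]} {α l : ℕ} (hl : 0 < l)
    (h : Tendsto (fun k => arcSum a b f (fun k => α + l * k) k) atTop (𝓝 L)) :
    HasArcIntegral a b (Phi α) f L := by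
  intro ε hε
  obtain ⟨K, hK⟩ := Metric.tendsto_atTop.1 h ε hε
  refine ⟨K + 1, K.succ_pos, _, ⟨l, hl, fun _ => rfl⟩, fun k hk => ?_⟩
  rw [← dist_eq_norm]
  exact hK k (by omega)

/-- The mean value of `ζ / (ζ - r)` over the `N`-th roots of unity is `1 / (1 - r ^ N)`, so the arc
sum of `f'/f` splits into one such term for each zero or pole and the mean value of the restricted
power series `L`. -/
lemma arcSum_logDeriv_eq {f : ℂ_[p] → ℂ_[p]} {a b : ℂ_[p]} {D : ℂ_[p] →₀ ℤ} {L : ℂ_[p]⟦X⟧}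
    (hlog : ∀ t, ‖t‖ ≤ 1 → D t = 0 →
      (b - a) * (deriv f (a + (b - a) * t) / f (a + (b - a) * t)) =
        (D.sum fun r n => n / (t - r)) + evalTsum L t) {φ : ℕ → ℕ} {k : ℕ}
    (hD : ∀ r ∈ D.support, r ^ p ^ φ k ≠ 1) :
    arcSum a b (fun x => deriv f x / f x) φ k =
      (∑ r ∈ D.support, 1 / (1 - r ^ p ^ φ k) * D r) + ((p ^ φ k : ℕ) : ℂ_[p])⁻¹ *
        ∑ ζ ∈ Polynomial.nthRootsFinset (p ^ φ k) (1 : ℂ_[p]), ζ * evalTsum L ζ := by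
  have hN : p ^ φ k ≠ 0 := pow_ne_zero _ (Fact.out : p.Prime).ne_zero
  have hN' : ((p ^ φ k : ℕ) : ℂ_[p]) ≠ 0 := Nat.cast_ne_zero.2 hN
  rw [arcSum, ← Nat.cast_pow]
  have hterm : ∀ ζ ∈ Polynomial.nthRootsFinset (p ^ φ k) (1 : ℂ_[p]),
      (a + (b - a) * ζ - a) * (deriv f (a + (b - a) * ζ) / f (a + (b - a) * ζ)) =
        (∑ r ∈ D.support, D r * (ζ / (ζ - r))) + ζ * evalTsum L ζ := by
    intro ζ hζ
    have hζN := (Polynomial.mem_nthRootsFinset (Nat.pos_of_ne_zero hN) 1).1 hζ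
    have hζ1 : ‖ζ‖ ≤ 1 :=
      (isOfFinOrder_iff_pow_eq_one.2 ⟨_, Nat.pos_of_ne_zero hN, hζN⟩).norm_eq_one.le
    have hDζ : D ζ = 0 := by
      by_contra h
      exact hD ζ (Finsupp.mem_support_iff.2 h) hζN
    rw [add_sub_cancel_left, mul_comm (b - a) ζ, mul_assoc, mul_comm ζ (b - a), hlog ζ hζ1 hDζ,
      mul_add, Finsupp.sum, Finset.mul_sum]
    congr 1
    exact Finset.sum_congr rfl fun r _ => by ring
  rw [Finset.sum_congr rfl hterm, Finset.sum_add_distrib, mul_add, Finset.sum_comm, Finset.mul_sum]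
  congr 1
  refine Finset.sum_congr rfl fun r hr => ?_
  rw [← Finset.mul_sum, sum_nthRootsFinset_div_sub hN (hD r hr)]
  field_simp

/-- The arc integral of `f'/f` when the zeros and poles lie in disjoint open discs that do not
contain `b`. -/
theorem hasArcIntegral_logDeriv_of_discs {a b : ℂ_[p]} {R : ℝ} (hR : 0 < R) (hb : ‖b - a‖ = R)
    {f : ℂ_[p] → ℂ_[p]} (hf : MeromorphicOnDisc f a R) (α : ℕ) {M : ℕ} {z : Fin M → ℂ_[p]}
    (hz : ∀ i, z i ∈ Metric.closedBall a R)
    (hdisj : ∀ i j, i ≠ j → Disjoint (Metric.ball (z i) R) (Metric.ball (z j) R))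
    (hcover : ∀ x ∈ zerosAndPoles f (Metric.closedBall a R), ∃ i, x ∈ Metric.ball (z i) R)
    (hbz : ∀ i, b ∉ Metric.ball (z i) R) :
    (zerosAndPoles f (Metric.closedBall a R)).Finite ∧
      (∀ i, 1 - teichmuller ((a - z i) / (a - b)) ^ p ^ α ≠ 0) ∧
      HasArcIntegral a b (Phi α) (fun x => deriv f x / f x)
        (∑ i, 1 / (1 - teichmuller ((a - z i) / (a - b)) ^ p ^ α) *
          ((zeroCount f (Metric.ball (z i) R) : ℂ_[p]) -
            (poleCount f (Metric.ball (z i) R) : ℂ_[p]))) := by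
  classical
  have hp : p.Prime := Fact.out
  have hpK := PadicComplex.norm_prime_lt_one (p := p)
  have hβ : b - a ≠ 0 := norm_pos_iff.1 (hb ▸ hR)
  have hbmem : b ∈ Metric.closedBall a R := by rw [mem_closedBall_iff_norm, hb]
  have hord : meromorphicOrderAt f b = 0 := by
    by_contra h
    obtain ⟨i, hi⟩ := hcover b ⟨hbmem, h⟩
    exact hbz i hi
  obtain ⟨D, L, hDs, hL, hD, hlog⟩ :=
    hf.exists_divisor hR hb (by rw [hord]; exact WithTop.zero_ne_top)
  -- the centres of the discs and their Teichmüller representatives in the coordinate `t`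
  set w : Fin M → ℂ_[p] := fun i => (a - z i) / (a - b) with hw
  set ω : Fin M → ℂ_[p] := fun i => teichmuller (w i) with hωdef
  have hzw : ∀ i, z i = a + (b - a) * w i := fun i => by
    have hab : a - b ≠ 0 := fun h => hβ (by rw [← neg_sub, h, neg_zero])
    simp only [hw]
    field_simp
    ring
  have hball : ∀ i t, a + (b - a) * t ∈ Metric.ball (z i) R ↔ ‖t - w i‖ < 1 := fun i t => by
    rw [mem_ball_iff_norm, hzw, add_sub_add_left_eq_sub, ← mul_sub, norm_mul, hb,
      mul_lt_iff_lt_one_right hR]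
  have hw1 : ∀ i, ‖w i‖ ≤ 1 := fun i => by
    have h := hz i
    rw [hzw, mem_closedBall_iff_norm, add_sub_cancel_left, norm_mul, hb] at h
    exact (mul_le_iff_le_one_right hR).1 h
  have hwω : ∀ i, ‖w i - ω i‖ < 1 := fun i => norm_sub_teichmuller_lt (hw1 i)
  have hω1 : ∀ i, ‖ω i‖ ≤ 1 := fun i =>
    norm_le_one_of_norm_sub_le (by rw [norm_sub_rev]; exact (hwω i).le) (hw1 i)
  -- no disc meets the residue disc of `t = 1`, which is the arc
  have hfar : ∀ i t, ‖t - w i‖ < 1 → ¬ ‖t - 1‖ < 1 := fun i t hti ht => by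
    refine hbz i ?_
    have hb1 : b = a + (b - a) * 1 := by ring
    rw [hb1, hball]
    rw [norm_sub_rev] at ht
    exact norm_sub_lt_one_trans ht hti
  have hωne : ∀ i, 1 - ω i ^ p ^ α ≠ 0 := fun i h => by
    refine hfar i (ω i) (by rw [norm_sub_rev]; exact hwω i)
      (norm_sub_one_lt_of_norm_pow_prime_pow_sub_one_lt (n := α) hp hpK (hω1 i) ?_)
    rw [← neg_sub, h]
    simp
  have hDball : ∀ r ∈ D.support, ∃ i, ‖r - w i‖ < 1 := fun r hr => by
    obtain ⟨i, hi⟩ := hcover (a + (b - a) * r) ⟨affine_mem_closedBall hb (hDs r hr), by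
      rw [hD r (hDs r hr)]
      exact_mod_cast Finsupp.mem_support_iff.1 hr⟩
    exact ⟨i, (hball i r).1 hi⟩
  have hDne : ∀ r ∈ D.support, ∀ n, r ^ p ^ n ≠ 1 := fun r hr n h => by
    obtain ⟨i, hi⟩ := hDball r hr
    refine hfar i r hi
      (norm_sub_one_lt_of_norm_pow_prime_pow_sub_one_lt (n := n) hp hpK (hDs r hr) ?_)
    rw [h]
    simp
  refine ⟨?_, hωne, ?_⟩
  · refine (D.support.finite_toSet.image fun r => a + (b - a) * r).subset ?_
    rintro x ⟨hx, hxo⟩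
    have hxt : a + (b - a) * ((x - a) / (b - a)) = x := by
      rw [mul_div_cancel₀ _ hβ, add_sub_cancel]
    have ht : ‖(x - a) / (b - a)‖ ≤ 1 := by
      rw [norm_div, hb, div_le_one hR]
      exact mem_closedBall_iff_norm.1 hx
    refine ⟨(x - a) / (b - a), ?_, hxt⟩
    rw [Finset.mem_coe, Finsupp.mem_support_iff]
    intro h0
    rw [← hxt, hD _ ht, h0] at hxo
    exact hxo rfl
  · -- a common exponent `l` with `ω i ^ p ^ l = ω i` for all `i`
    choose e he0 he using fun i => exists_teichmuller_pow_eq (w i)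
    have hl : 0 < ∏ i, e i := Finset.prod_pos fun i _ => he0 i
    have hωl : ∀ i, ω i ^ p ^ (∏ j, e j) = ω i := fun i => by
      obtain ⟨m, hm⟩ := Finset.dvd_prod_of_mem e (Finset.mem_univ i)
      rw [hm, pow_mul]
      clear hm
      induction m with
      | zero => simp
      | succ m ih => rw [pow_succ, pow_mul, ih]; exact he i
    refine hasArcIntegral_of_tendsto hl ?_
    simp only [arcSum_logDeriv_eq hlog (φ := fun k => α + (∏ i, e i) * k)
      (fun r hr => hDne r hr _)]
    have hval : ∑ i, 1 / (1 - ω i ^ p ^ α) * ((zeroCount f (Metric.ball (z i) R) : ℂ_[p]) -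
        (poleCount f (Metric.ball (z i) R) : ℂ_[p])) =
        ∑ r ∈ D.support, ∑ i with ‖r - w i‖ < 1, 1 / (1 - ω i ^ p ^ α) * (D r : ℂ_[p]) := by
      have hsub : ∀ i, Metric.ball (z i) R ⊆ Metric.closedBall a R := fun i x hx => by
        rw [mem_ball_iff_norm] at hx
        have h2 := mem_closedBall_iff_norm.1 (hz i)
        rw [mem_closedBall_iff_norm, ← sub_add_sub_cancel x (z i) a]
        exact (IsUltrametricDist.norm_add_le_max _ _).trans (max_le hx.le h2)
      simp only [zeroCount_sub_poleCount hR hb hDs hD (hsub _), hball, Finset.mul_sum,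
        Finset.sum_filter]
      rw [Finset.sum_comm]
      simp only [mul_ite, mul_zero]
    rw [hval, ← add_zero (∑ r ∈ D.support, _)]
    refine Tendsto.add (tendsto_finsetSum _ fun r hr => ?_) (tendsto_mean_mul_evalTsum hL hl)
    obtain ⟨i, hi⟩ := hDball r hr
    have huniq : (Finset.univ.filter fun j => ‖r - w j‖ < 1) = {i} := by
      ext j
      simp only [Finset.mem_filter, Finset.mem_univ, true_and, Finset.mem_singleton]
      refine ⟨fun hj => ?_, fun h => h ▸ hi⟩
      by_contra hne
      exact Set.disjoint_left.1 (hdisj j i hne) ((hball j r).2 hj) ((hball i r).2 hi)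
    rw [huniq, Finset.sum_singleton]
    have hrω : ‖r - ω i‖ < 1 := norm_sub_lt_one_trans hi (hwω i)
    have hlim := tendsto_pow_of_teichmuller (α := α) (hDs r hr) (hω1 i) hrω hl (hωl i)
    exact (tendsto_const_nhds.div (tendsto_const_nhds.sub hlim) (hωne i)).mul_const _

lemma finsum_mem_congr_of_zerosAndPoles_subset {f : ℂ_[p] → ℂ_[p]} {a : ℂ_[p]} {R : ℝ}
    (h : zerosAndPoles f (Metric.closedBall a R) ⊆ Metric.ball a R) {q : ℤ → ℕ} (hq : q 0 = 0) :
    ∑ᶠ x ∈ Metric.ball a R, q (meromorphicOrderAt f x).untop₀ =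
      ∑ᶠ x ∈ Metric.closedBall a R, q (meromorphicOrderAt f x).untop₀ := by
  refine finsum_mem_inter_support_eq' _ _ _ fun x hx =>
    ⟨fun hx' => Metric.ball_subset_closedBall hx', fun hx' => h ⟨hx', fun h0 => hx ?_⟩⟩
  simpa [h0] using hq

end PadicArc

end

theorem mainTheorem5 (p : ℕ) [Fact p.Prime] (hp : p ≠ 2)
    (a b : ℂ_[p]) (R : ℝ) (hR : 0 < R) (hb : ‖b - a‖ = R)
    (f : ℂ_[p] → ℂ_[p]) (hf : PadicArc.MeromorphicOnDisc f a R) (α : ℕ) :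
    (∀ (M : ℕ) (z : Fin M → ℂ_[p]),
      (∀ i, z i ∈ Metric.closedBall a R) →
      (∀ i j, i ≠ j → Disjoint (Metric.ball (z i) R) (Metric.ball (z j) R)) →
      (∀ x ∈ PadicArc.zerosAndPoles f (Metric.closedBall a R), ∃ i, x ∈ Metric.ball (z i) R) →
      (∀ i, b ∉ Metric.ball (z i) R) →
      (PadicArc.zerosAndPoles f (Metric.closedBall a R)).Finite ∧
      (∀ i, 1 - PadicArc.teichmuller ((a - z i) / (a - b)) ^ p ^ α ≠ 0) ∧
      PadicArc.HasArcIntegral a b (PadicArc.Phi α) (fun x => deriv f x / f x)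
        (∑ i, 1 / (1 - PadicArc.teichmuller ((a - z i) / (a - b)) ^ p ^ α) *
          ((PadicArc.zeroCount f (Metric.ball (z i) R) : ℂ_[p]) -
            (PadicArc.poleCount f (Metric.ball (z i) R) : ℂ_[p])))) ∧
    (PadicArc.zerosAndPoles f (Metric.closedBall a R) ⊆ Metric.ball a R →
      (PadicArc.zerosAndPoles f (Metric.closedBall a R)).Finite ∧
      PadicArc.HasArcIntegral a b (PadicArc.Phi α) (fun x => deriv f x / f x)
        ((PadicArc.zeroCount f (Metric.closedBall a R) : ℂ_[p]) -
          (PadicArc.poleCount f (Metric.closedBall a R) : ℂ_[p]))) := by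
  refine ⟨fun M z hz hdisj hcover hbz =>
    PadicArc.hasArcIntegral_logDeriv_of_discs hR hb hf α hz hdisj hcover hbz, fun hsub => ?_⟩
  -- the single disc around `a` itself, whose Teichmüller representative is `0`
  obtain ⟨hfin, -, hint⟩ := PadicArc.hasArcIntegral_logDeriv_of_discs hR hb hf α (M := 1)
    (z := fun _ => a) (fun _ => Metric.mem_closedBall_self hR.le)
    (fun i j hij => absurd (Subsingleton.elim i j) hij) (fun x hx => ⟨0, hsub hx⟩)
    (fun _ h => by rw [mem_ball_iff_norm, hb] at h; exact lt_irrefl _ h)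
  refine ⟨hfin, ?_⟩
  have hω : PadicArc.teichmuller (0 : ℂ_[p]) = 0 := by simp [PadicArc.teichmuller]
  have hZ : PadicArc.zeroCount f (Metric.ball a R) = PadicArc.zeroCount f (Metric.closedBall a R) :=
    PadicArc.finsum_mem_congr_of_zerosAndPoles_subset hsub (q := Int.toNat) rfl
  have hP : PadicArc.poleCount f (Metric.ball a R) = PadicArc.poleCount f (Metric.closedBall a R) :=
    PadicArc.finsum_mem_congr_of_zerosAndPoles_subset hsub (q := fun n => (-n).toNat) rfl
  have h0 : p ^ α ≠ 0 := pow_ne_zero _ (Fact.out : p.Prime).ne_zero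
  simpa [hω, hZ, hP, zero_pow h0] using hint
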